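/- Setting. There are $m\ge 2$ arms with reward distributions $D_1,\dots,D_m$ supported on $[0,1]$, with means $\mu_1,\dots,\mu_m$, and a unique arm $a^*$ of largest mean. Pulling arm $i$ gives an independent observation from $D_i$. Put $\Delta_i=\mu_{a^*}-\mu_i$ for $i\ne a^*$, $\Delta_{a^*}=\mu_{a^*}-\max_{i\ne a^*}\mu_i$, and $H_m=\sum_{i=1}^m \Delta_i^{-2}$. For $0<x<1/2$ let $\phi(x)$ be the number with $\Pr[Z\ge\phi(x)]=x$ for $Z\sim\mathcal N(0,1)$. The algorithm TS-Explore with parameters $0<\delta\le q\le 0.1$. Pull each arm once. Then, at each time step $t=m+1,m+2,\dots$, let $N_i$ be the number of observations of arm $i$ so far and $\hat\mu_i$ their average, and put $L_t=\log(12m^2t^2/\delta)$, $M_t=\lceil L_t/q\rceil$, $C_t=L_t/\phi(q)^2$. Let $\hat a\in\operatorname{argmax}_i\hat\mu_i$. For $k=1,\dots,M_t$ draw $\theta^k_i\sim\mathcal N(\hat\mu_i,C_t/N_i)$, $i=1,\dots,m$, all independently, and let $\tilde a^k\in\operatorname{argmax}_i\theta^k_i$. If $\tilde a^k=\hat a$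 for all $k\le M_t$, stop and output $\hat a$. Otherwise let $k^*$ maximize $\theta^k_{\tilde a^k}-\theta^k_{\hat a}$ over $k\le M_t$, and pull an arm in $\{\hat a\}\oplus\{\tilde a^{k^*}\}$ ($\oplus$ denotes the symmetric difference) with the least number of observations. All ties are broken by arbitrary fixed (measurable) rules. The complexity is the total number of observations made when the algorithm stops. Statement. There is a universal constant $K>0$ such that, for all $m\ge2$, all $D_1,\dots,D_m$ as above and all tie-breaking rules: 1. for all $0<\delta\le q\le 0.1$, with probability at least $1-\delta$, TS-Explore stops and outputs $a^*$ with complexity at most $$K\left(H_m\Big(\log\tfrac1\delta+\log(mH_m)\Big)\frac{\log\frac1\delta}{\log\frac1q}+H_m\frac{\log^2(mH_m)}{\log\frac1q}\right);$$ 2. for all $0<\delta\le 0.1$ and $q=\delta$, with probability at least $1-\delta$, TS-Explore stops and outputs $a^*$ with complexity at most $K\left(H_m\log\frac1\delta+H_m\log^2(mH_m)\right)$; 3. consequently, as $\delta\to0$ with $q=\delta$, the complexity has the order $H_m\log\frac1\delta$: there is $\delta_0>0$, depending on the instance, such that for all $0<\delta<\delta_0$, with probability at least $1-\delta$, TS-Explore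 with $q=\delta$ stops and outputs $a^*$ with complexity at most $K\,H_m\log\frac1\delta$. -/

import Mathlib

open MeasureTheory ProbabilityTheory Filter Topology

/-- The upper tail `Pr[X ≥ x]` of a standard normal random variable `X`. -/
noncomputable def gaussTail (x : ℝ) : ℝ := (gaussianReal 0 1).real (Set.Ici x)

/-- The upper quantile function of the standard normal law: `gaussTail (upperQuantile x) = x`
for `0 < x < 1/2` (see `gaussTail_upperQuantile`). -/
noncomputable def upperQuantile (x : ℝ) : ℝ := Function.invFun gaussTail x

theorem gaussTail_upperQuantile {x : ℝ} (h0 : 0 < x) (h1 : x < 1 / 2) :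
    gaussTail (upperQuantile x) = x := by
  have := nullSingletonClass_gaussianReal (μ := 0) (v := 1) one_ne_zero
  have hc : ∀ y, gaussTail y = 1 - cdf (gaussianReal 0 1) y := by
    intro y
    rw [gaussTail, cdf_eq_real, ← Set.compl_Iio, probReal_compl_eq_one_sub measurableSet_Iio]
    congr 1
    exact measureReal_congr Iio_ae_eq_Iic
  have hcont : Continuous gaussTail := by
    have h2 : Continuous (cdf (gaussianReal 0 1)) := by
      rw [continuous_iff_continuousAt]
      intro y
      rw [(monotone_cdf (gaussianReal 0 1)).continuousAt_iff_leftLim_eq_rightLim,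
        StieltjesFunction.rightLim_eq]
      have h3 := StieltjesFunction.measure_singleton (cdf (gaussianReal 0 1)) y
      rw [measure_cdf, measure_singleton] at h3
      have h4 := ENNReal.ofReal_eq_zero.1 h3.symm
      exact le_antisymm ((monotone_cdf _).leftLim_le le_rfl) (by linarith)
    rw [funext hc]
    exact continuous_const.sub h2
  have hbot : Tendsto gaussTail atBot (𝓝 1) := by
    simpa only [funext hc, sub_zero] using (tendsto_cdf_atBot (gaussianReal 0 1)).const_sub 1
  have htop : Tendsto gaussTail atTop (𝓝 0) := by
    simpa only [funext hc, sub_self] using (tendsto_cdf_atTop (gaussianReal 0 1)).const_sub 1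
  obtain ⟨a, ha⟩ := (htop.eventually (gt_mem_nhds h0)).exists
  obtain ⟨b, hb⟩ := (hbot.eventually (lt_mem_nhds (show x < 1 by linarith))).exists
  obtain ⟨c, hx⟩ := mem_range_of_exists_le_of_exists_ge hcont ⟨a, ha.le⟩ ⟨b, hb.le⟩
  exact Function.invFun_eq ⟨c, hx⟩

namespace TSExplore

/-! ### Bandit instances -/

/-- The expected reward of arm `i`. -/
noncomputable def mean {m : ℕ} (D : Fin m → ProbabilityMeasure ℝ) (i : Fin m) : ℝ :=
  ∫ x, x ∂(D i : Measure ℝ)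

/-- All reward distributions are supported on `[0,1]`, and `a` is the unique arm with the largest
expected reward. -/
def IsInstance {m : ℕ} (D : Fin m → ProbabilityMeasure ℝ) (a : Fin m) : Prop :=
  (∀ i, (D i : Measure ℝ) (Set.Icc 0 1)ᶜ = 0) ∧ ∀ i, i ≠ a → mean D i < mean D a

/-- The gap of arm `i`, where `a` is the optimal arm. For `i = a` it is the distance to the second
largest expected reward (meaningful when there are at least two arms). -/
noncomputable def gap {m : ℕ} (D : Fin m → ProbabilityMeasure ℝ) (a i : Fin m) : ℝ :=
  if i = a then mean D a - ⨆ j : {j : Fin m // j ≠ a}, mean D j else mean D a - mean D i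

/-- The hardness `H` of an instance, the sum of the inverse squared gaps. -/
noncomputable def hardness {m : ℕ} (D : Fin m → ProbabilityMeasure ℝ) (a : Fin m) : ℝ :=
  ∑ i, 1 / gap D a i ^ 2

/-! ### The parameters of the algorithm -/

/-- `log (12 m² t² / δ)`. -/
noncomputable def logTerm (m : ℕ) (δ : ℝ) (t : ℕ) : ℝ :=
  Real.log (12 * (m : ℝ) ^ 2 * (t : ℝ) ^ 2 / δ)

/-- The number `M` of sample sets drawn at time `t`, rounded up to an integer. -/
noncomputable def numSamples (m : ℕ) (δ q : ℝ) (t : ℕ) : ℕ := ⌈1 / q * logTerm m δ t⌉₊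

/-- The variance parameter `C` at time `t`. -/
noncomputable def varParam (m : ℕ) (δ q : ℝ) (t : ℕ) : ℝ :=
  logTerm m δ t / upperQuantile q ^ 2

/-- The rules by which the algorithm selects a maximizer or minimizer. Only the tie-breaking is
left free. -/
structure Rules (m : ℕ) where
  /-- The offline oracle: a best arm under the given parameters. -/
  oracle : (Fin m → ℝ) → Fin m
  measurable_oracle : Measurable oracle
  le_oracle : ∀ (θ : Fin m → ℝ) (i : Fin m), θ i ≤ θ (oracle θ)
  /-- `argmaxIdx M g` is an index `k < M` that maximizes `g k`. -/
  argmaxIdx : ℕ → (ℕ → ℝ) → ℕ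
  measurable_argmaxIdx : ∀ M, Measurable (argmaxIdx M)
  argmaxIdx_lt : ∀ (M : ℕ) (g : ℕ → ℝ), 0 < M → argmaxIdx M g < M
  le_argmaxIdx : ∀ (M : ℕ) (g : ℕ → ℝ), ∀ k < M, g k ≤ g (argmaxIdx M g)
  /-- `leastPulled N S` is an arm in `S` with the least number of pulls. -/
  leastPulled : (Fin m → ℕ) → Finset (Fin m) → Fin m
  leastPulled_mem : ∀ (N : Fin m → ℕ) (S : Finset (Fin m)), S.Nonempty → leastPulled N S ∈ S
  leastPulled_le : ∀ (N : Fin m → ℕ) (S : Finset (Fin m)), ∀ i ∈ S, N (leastPulled N S) ≤ N i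

/-- Such rules exist, for example those that break ties in favour of the smallest index. -/
theorem Rules.nonempty {m : ℕ} (hm : 0 < m) : Nonempty (Rules m) := by
  classical
  have : Nonempty (Fin m) := ⟨⟨0, hm⟩⟩
  have hor : ∀ θ : Fin m → ℝ, ∃ n : ℕ, ∃ h : n < m, ∀ i, θ i ≤ θ ⟨n, h⟩ := fun θ => by
    obtain ⟨i, hi⟩ := Finite.exists_max θ
    exact ⟨i, i.2, hi⟩
  have hk : ∀ (M : ℕ) (g : ℕ → ℝ), ∃ n : ℕ, (0 < M → n < M) ∧ ∀ k < M, g k ≤ g n := fun M g => by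
    rcases Nat.eq_zero_or_pos M with rfl | hM
    · exact ⟨0, fun h => h, fun k hk => absurd hk (Nat.not_lt_zero k)⟩
    · obtain ⟨n, hn, h⟩ := Finset.exists_max_image (Finset.range M) g ⟨0, by simpa using hM⟩
      exact ⟨n, fun _ => by simpa using hn, fun k hk => h k (by simpa using hk)⟩
  have hl : ∀ (N : Fin m → ℕ) (S : Finset (Fin m)), ∃ i, (S.Nonempty → i ∈ S) ∧
      ∀ j ∈ S, N i ≤ N j := fun N S => by
    rcases S.eq_empty_or_nonempty with rfl | hS
    · exact ⟨⟨0, hm⟩, by simp, by simp⟩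
    · obtain ⟨i, hi, h⟩ := S.exists_min_image N hS
      exact ⟨i, fun _ => hi, h⟩
  choose pick hpick using hl
  refine ⟨⟨fun θ => ⟨Nat.find (hor θ), (Nat.find_spec (hor θ)).1⟩, ?_,
    fun θ => (Nat.find_spec (hor θ)).2, fun M g => Nat.find (hk M g), fun M => ?_,
    fun M g => (Nat.find_spec (hk M g)).1, fun M g => (Nat.find_spec (hk M g)).2, pick,
    fun N S => (hpick N S).1, fun N S => (hpick N S).2⟩⟩
  · have h1 : Measurable fun θ => Nat.find (hor θ) := by
      refine measurable_find hor fun n => ?_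
      by_cases h : n < m
      · simp only [h, exists_true_left]
        measurability
      · simp [h]
    refine measurable_to_countable' fun i => ?_
    convert h1 (measurableSet_singleton (i : ℕ)) using 1
    ext θ
    simp [Fin.ext_iff]
  · refine measurable_find (hk M) fun n => ?_
    measurability

/-! ### The randomness -/

/-- A sample point consists of a table of rewards, whose entry `(i, n)` is the reward observed when
arm `i` is pulled for the `(n+1)`-st time, and a table of noise variables, whose entry `(t, k, i)`
is used to draw the `k`-th sample of arm `i` at time `t`. -/
abbrev Outcome (m : ℕ) : Type := (Fin m × ℕ → ℝ) × (ℕ × ℕ × Fin m → ℝ)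

/-- All the entries are independent; rewards of arm `i` have law `D i`, noise variables are
standard normal. -/
noncomputable def law {m : ℕ} (D : Fin m → ProbabilityMeasure ℝ) : Measure (Outcome m) :=
  (Measure.infinitePi fun p : Fin m × ℕ => (D p.1 : Measure ℝ)).prod
    (Measure.infinitePi fun _ : ℕ × ℕ × Fin m => gaussianReal 0 1)

/-! ### The algorithm -/

/-- The state of the algorithm at the beginning of a time step. -/
structure State (m : ℕ) where
  /-- The number of observations of each arm. -/
  N : Fin m → ℕ
  /-- The sum of the observations of each arm. -/
  R : Fin m → ℝ
  /-- The arm that has been output, if the algorithm has stopped. -/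
  out : Option (Fin m)

/-- The empirical mean of each arm. -/
noncomputable def State.empMean {m : ℕ} (s : State m) (i : Fin m) : ℝ := s.R i / s.N i

/-- Pull arm `i`: its `N i + 1`-st observation is made. -/
def State.pull {m : ℕ} (s : State m) (X : Fin m × ℕ → ℝ) (i : Fin m) : State m where
  N := Function.update s.N i (s.N i + 1)
  R := Function.update s.R i (s.R i + X (i, s.N i))
  out := s.out

/-- The `k`-th sample set at time `t`. Given the past, the coordinates are independent and the
`i`-th one has the normal law with the empirical mean of `i` as its mean and variance
`varParam m δ q t / N i`. -/
noncomputable def State.sample {m : ℕ} (s : State m) (δ q : ℝ) (ξ : ℕ × ℕ × Fin m → ℝ)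
    (t k : ℕ) (i : Fin m) : ℝ :=
  s.empMean i + Real.sqrt (varParam m δ q t / s.N i) * ξ (t, k, i)

/-- One iteration of the main loop, at time `t`. A stopped algorithm does not change any more. -/
noncomputable def step {m : ℕ} (r : Rules m) (δ q : ℝ) (ω : Outcome m) (t : ℕ)
    (s : State m) : State m :=
  open Classical in
  if s.out ≠ none then s
  else
    let M := numSamples m δ q t
    let θ := s.sample δ q ω.2 t
    let best := r.oracle s.empMean
    let cand := fun k => r.oracle (θ k)
    let diff := fun k => θ k (cand k) - θ k best
    if ∀ k < M, cand k = best then { s with out := some best }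
    else s.pull ω.1 (r.leastPulled s.N (symmDiff {best} {cand (r.argmaxIdx M diff)}))

/-- The state after the initial round, in which each arm is pulled once. -/
def initState {m : ℕ} (ω : Outcome m) : State m where
  N := fun _ => 1
  R := fun i => ω.1 (i, 0)
  out := none

/-- The state after `n` iterations of the main loop, that is, at the beginning of time step
`m + n + 1`. -/
noncomputable def run {m : ℕ} (r : Rules m) (δ q : ℝ) (ω : Outcome m) : ℕ → State m
  | 0 => initState ω
  | n + 1 => step r δ q ω (m + n + 1) (run r δ q ω n)

/-- The event that the algorithm stops and outputs arm `a`, with complexity (the total number of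
observations when it stops) at most `B`. -/
def outputsWithin {m : ℕ} (r : Rules m) (δ q : ℝ) (a : Fin m) (B : ℝ) : Set (Outcome m) :=
  {ω | ∃ n, (run r δ q ω n).out = some a ∧ ((∑ i, (run r δ q ω n).N i : ℕ) : ℝ) ≤ B}

end TSExplore

/-! ### The standard normal law -/

/-! Write `L` for the logarithmic term at time `t`, `C = L / φ(q)²`, and `b` for the empirically
best arm. With probability at least `1 - δ` four things hold at every iteration. Empirical means lie
within `√(L / (2 N i))` of the true means (Hoeffding over fixed pull counts). All noise variables in
use are at most `√(2 logSamples)` (union bound over samples and arms). If `b ≠ a`, some sample puts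
`a` above `b` by the empirical difference plus `φ(q) √(C/N a + C/N b)`: each sample does so with
probability exactly `q`, independently of the past, so all `M ≥ L/q` fail with probability at most
`(1 - q)^M ≤ exp (-L)`. Finally, samples have no ties.

The scale `C` is chosen so that this margin equals `√(L/N a + L/N b)`, which dominates the two
confidence radii together. Hence the good sample favours `a` over `b` by at least the true gap
(`GoodStep.exists_gap_le`). Stopping on a wrong arm is therefore impossible
(`GoodStep.best_eq_of_forall_cand_eq`). When the algorithm goes on, the pulled arm has a gap bounded
by twice its confidence radius plus sampling radius (`GoodStep.gap_next_le`). Since `φ(q)² ≥ log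
(1/q) / 8` and `logSamples ≤ 3 L`, an arm can be pulled only while its count is `O(L² / (log (1/q) ·
gap²))` (`GoodStep.N_next_le`).

Summing over arms bounds the number `T` of observations by `m + O(H L_T² / log (1/q))`. As `L_T`
grows only logarithmically in `T`, this implicit inequality can be solved (`le_of_le_mul_log_sq`),
giving `T = O(H (log² (1/δ) + log² (m H)) / log (1/q))`. All three claims follow from this one
bound. -/

theorem gaussTail_antitone : Antitone gaussTail := fun _ _ h =>
  measureReal_mono (Set.Ici_subset_Ici.2 h)

theorem hasSubgaussianMGF_of_hasLaw_gaussianReal {Ω : Type*} [MeasurableSpace Ω] {P : Measure Ω}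
    {X : Ω → ℝ} (hX : HasLaw X (gaussianReal 0 1) P) : HasSubgaussianMGF X 1 P := by
  refine ⟨fun t => ?_, fun t => ?_⟩
  · have h := integrable_exp_mul_gaussianReal (μ := 0) (v := 1) t
    rw [← hX.map_eq] at h
    exact h.comp_aemeasurable hX.aemeasurable
  · rw [mgf_gaussianReal hX.map_eq]
    simp

theorem measureReal_lt_abs_le_of_hasLaw_gaussianReal {Ω : Type*} [MeasurableSpace Ω]
    {P : Measure Ω} [IsProbabilityMeasure P] {X : Ω → ℝ} (hX : HasLaw X (gaussianReal 0 1) P)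
    {s : ℝ} (hs : 0 ≤ s) : P.real {ω | s < |X ω|} ≤ 2 * Real.exp (-s ^ 2 / 2) := by
  have h := hasSubgaussianMGF_of_hasLaw_gaussianReal hX
  have h1 := h.measure_ge_le hs
  have h2 := h.neg.measure_ge_le hs
  have h3 : {ω | s < |X ω|} ⊆ {ω | s ≤ X ω} ∪ {ω | s ≤ (-X) ω} := by
    intro ω (hω : s < |X ω|)
    rcases lt_abs.1 hω with h | h
    · exact Or.inl h.le
    · exact Or.inr h.le
  simp only [NNReal.coe_one, mul_one] at h1 h2
  calc _ ≤ _ := measureReal_mono h3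
    _ ≤ _ := measureReal_union_le _ _
    _ ≤ _ := by linarith

/-- On `[x, x + 1]` the density is at least its value at the right endpoint, and the interval has
length one. -/
theorem exp_le_gaussTail {x : ℝ} (hx : 0 ≤ x) :
    (√(2 * Real.pi))⁻¹ * Real.exp (-(x + 1) ^ 2 / 2) ≤ gaussTail x := by
  have h1 : (gaussianReal 0 1).real (Set.Icc x (x + 1)) ≤ gaussTail x :=
    measureReal_mono Set.Icc_subset_Ici_self
  refine le_trans ?_ h1
  rw [measureReal_def, gaussianReal_apply_eq_integral _ one_ne_zero, ENNReal.toReal_ofReal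
    (integral_nonneg fun _ => gaussianPDFReal_nonneg _ _ _)]
  have h2 := setIntegral_ge_of_const_le_real (μ := volume) (s := Set.Icc x (x + 1))
    (f := gaussianPDFReal 0 1) (c := (√(2 * Real.pi))⁻¹ * Real.exp (-(x + 1) ^ 2 / 2))
    measurableSet_Icc (by simp) ?_ (integrable_gaussianPDFReal 0 1).integrableOn
  · simpa [measureReal_def] using h2
  · intro y hy
    simp only [gaussianPDFReal, NNReal.coe_one, mul_one, sub_zero]
    gcongr
    · linarith [hy.1]
    · exact hy.2

theorem nine_div_four_le_log_ten : 9 / 4 ≤ Real.log 10 := by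
  rw [Real.le_log_iff_exp_le (by norm_num)]
  have h := Real.exp_one_lt_d9.le
  have h1 : Real.exp (9 / 4) ^ 4 = Real.exp 1 ^ 9 := by
    rw [← Real.exp_nat_mul, ← Real.exp_nat_mul]
    norm_num
  refine le_of_pow_le_pow_left₀ (n := 4) (by norm_num) (by norm_num) ?_
  rw [h1]
  calc Real.exp 1 ^ 9 ≤ 2.7182818286 ^ 9 := by gcongr
    _ ≤ _ := by norm_num

theorem log_one_div_ge {q : ℝ} (h0 : 0 < q) (h1 : q ≤ 1 / 10) : 9 / 4 ≤ Real.log (1 / q) :=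
  nine_div_four_le_log_ten.trans
    (Real.log_le_log (by norm_num) (by rw [le_div_iff₀ h0]; linarith))

/-- Otherwise the tail at `√(log (1/q) / 8)` would be at most `q`, against the lower bound
`exp_le_gaussTail`. A lower bound on the quantile is what keeps the sampling variance small. -/
theorem sqrt_log_le_upperQuantile {q : ℝ} (h0 : 0 < q) (h1 : q ≤ 1 / 10) :
    √(Real.log (1 / q) / 8) ≤ upperQuantile q := by
  have hl := log_one_div_ge h0 h1
  set l := Real.log (1 / q) with hldef
  by_contra! hlt
  have h2 := gaussTail_antitone hlt.le
  rw [gaussTail_upperQuantile h0 (by linarith)] at h2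
  have h3 := (exp_le_gaussTail (Real.sqrt_nonneg (l / 8))).trans h2
  set x := √(l / 8)
  have hx : x ^ 2 = l / 8 := Real.sq_sqrt (by linarith)
  have hq : q = Real.exp (-l) := by
    rw [hldef, one_div, Real.log_inv, neg_neg, Real.exp_log h0]
  -- Amounts to `2π < 6.6 < exp 1.9`.
  have hpi : Real.exp (-(19 / 20)) < (√(2 * Real.pi))⁻¹ := by
    rw [Real.exp_neg]
    refine inv_strictAnti₀ (by positivity) ?_
    rw [Real.sqrt_lt (by positivity) (by positivity), ← Real.exp_nat_mul]
    have h5 : (6.6 : ℝ) < Real.exp ((2 : ℕ) * (19 / 20)) := by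
      have e := Real.exp_one_gt_d9.le
      refine lt_of_pow_lt_pow_left₀ 10 (by positivity) ?_
      have e2 : Real.exp ((2 : ℕ) * (19 / 20)) ^ 10 = Real.exp 1 ^ 19 := by
        rw [← Real.exp_nat_mul, ← Real.exp_nat_mul]
        norm_num
      rw [e2]
      calc (6.6 : ℝ) ^ 10 < 2.7182818283 ^ 19 := by norm_num
        _ ≤ _ := by gcongr
    linarith [Real.pi_lt_d2]
  have h4 : Real.exp (-l) < Real.exp (-l) := by
    calc Real.exp (-l) ≤ Real.exp (-(19 / 20) + -(x + 1) ^ 2 / 2) := by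
          gcongr
          -- With `l = 8 x²` and `x ≤ (x² + 1) / 2`, it suffices that `7 x² ≥ 1.95`; this holds
          -- because `l ≥ 9/4` gives `x² ≥ 9/32`.
          nlinarith [sq_nonneg (x - 1)]
      _ = Real.exp (-(19 / 20)) * Real.exp (-(x + 1) ^ 2 / 2) := Real.exp_add _ _
      _ < (√(2 * Real.pi))⁻¹ * Real.exp (-(x + 1) ^ 2 / 2) := by gcongr
      _ ≤ q := h3
      _ = _ := hq
  exact lt_irrefl _ h4

theorem upperQuantile_pos {q : ℝ} (h0 : 0 < q) (h1 : q ≤ 1 / 10) : 0 < upperQuantile q :=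
  (Real.sqrt_pos.2 (by linarith [log_one_div_ge h0 h1])).trans_le (sqrt_log_le_upperQuantile h0 h1)

theorem log_le_upperQuantile_sq {q : ℝ} (h0 : 0 < q) (h1 : q ≤ 1 / 10) :
    Real.log (1 / q) / 8 ≤ upperQuantile q ^ 2 := by
  rw [← Real.sqrt_le_left (upperQuantile_pos h0 h1).le]
  exact sqrt_log_le_upperQuantile h0 h1

/-! ### Linear combinations of two independent standard normal variables. -/

section LinearCombination

variable {Ω : Type*} [MeasurableSpace Ω] {P : Measure Ω} {X Y : Ω → ℝ}

theorem map_mul_sub_mul_eq_gaussianReal (hX : HasLaw X (gaussianReal 0 1) P)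
    (hY : HasLaw Y (gaussianReal 0 1) P) (h : IndepFun X Y P) (a b : ℝ) :
    P.map (fun ω => a * X ω - b * Y ω) = gaussianReal 0 (a ^ 2 + b ^ 2).toNNReal := by
  have h1 := gaussianReal_const_mul hX a
  have h2 := gaussianReal_const_mul hY (-b)
  have h3 := gaussianReal_add_gaussianReal_of_indepFun
    (h.comp (measurable_const_mul a) (measurable_const_mul (-b))) h1.map_eq h2.map_eq
  convert h3 using 2
  · ext ω
    simp [sub_eq_add_neg]
  · simp
  · ext
    simp [Real.toNNReal_of_nonneg (add_nonneg (sq_nonneg a) (sq_nonneg b))]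

theorem measure_mul_sub_mul_eq_const (hX : HasLaw X (gaussianReal 0 1) P)
    (hY : HasLaw Y (gaussianReal 0 1) P) (h : IndepFun X Y P) {a b : ℝ} (ha : a ≠ 0) (c : ℝ) :
    P {ω | a * X ω - b * Y ω = c} = 0 := by
  have h1 := map_mul_sub_mul_eq_gaussianReal hX hY h a b
  have h2 : (a ^ 2 + b ^ 2).toNNReal ≠ 0 := by
    rw [Ne, Real.toNNReal_eq_zero]
    have := sq_pos_of_ne_zero ha
    nlinarith [sq_nonneg b]
  have := nullSingletonClass_gaussianReal (μ := 0) h2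
  have h3 : (P.map (fun ω => a * X ω - b * Y ω)) {c} = 0 := by rw [h1, measure_singleton]
  rwa [Measure.map_apply_of_aemeasurable _ (measurableSet_singleton c)] at h3
  exact (hX.aemeasurable.const_mul a).sub (hY.aemeasurable.const_mul b)

theorem measureReal_le_mul_sub_mul (hX : HasLaw X (gaussianReal 0 1) P)
    (hY : HasLaw Y (gaussianReal 0 1) P) (h : IndepFun X Y P) {a b : ℝ} (ha : a ≠ 0) (x : ℝ) :
    P.real {ω | x * √(a ^ 2 + b ^ 2) ≤ a * X ω - b * Y ω} = gaussTail x := by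
  have h0 : 0 < a ^ 2 + b ^ 2 := by
    have := sq_pos_of_ne_zero ha
    nlinarith [sq_nonneg b]
  have h1 := map_mul_sub_mul_eq_gaussianReal hX hY h a b
  have h2 : AEMeasurable (fun ω => a * X ω - b * Y ω) P :=
    (hX.aemeasurable.const_mul a).sub (hY.aemeasurable.const_mul b)
  have h3 := gaussianReal_map_const_mul (μ := 0) (v := 1) (√(a ^ 2 + b ^ 2))
  have h4 : gaussianReal 0 (a ^ 2 + b ^ 2).toNNReal
      = (gaussianReal 0 1).map (√(a ^ 2 + b ^ 2) * ·) := by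
    rw [h3]
    congr 1
    · simp
    · ext
      simp [Real.toNNReal_of_nonneg h0.le, Real.sq_sqrt h0.le]
  have h5 : P.real {ω | x * √(a ^ 2 + b ^ 2) ≤ a * X ω - b * Y ω}
      = (P.map (fun ω => a * X ω - b * Y ω)).real (Set.Ici (x * √(a ^ 2 + b ^ 2))) := by
    rw [measureReal_def, measureReal_def, Measure.map_apply_of_aemeasurable h2 measurableSet_Ici]
    rfl
  rw [h5, h1, h4, map_measureReal_apply (by fun_prop) measurableSet_Ici, gaussTail]
  congr 1
  ext y
  simp only [Set.mem_preimage, Set.mem_Ici]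
  rw [mul_comm]
  exact mul_le_mul_iff_right₀ (Real.sqrt_pos.2 h0)

end LinearCombination

/-! ### Independence of the rows of a table -/

/-- Currying turns the product measure on the table into a product of product measures, one for each
row. -/
theorem iIndepFun_rows_infinitePi {ι κ X : Type*} [MeasurableSpace X] (μ : Measure X)
    [IsProbabilityMeasure μ] :
    iIndepFun (fun (i : ι) (ω : ι × κ → X) (j : κ) => ω (i, j))
      (Measure.infinitePi fun _ : ι × κ => μ) := by
  rw [iIndepFun_iff_map_fun_eq_infinitePi_map (by fun_prop)]
  have h := Measure.infinitePi_map_curry (fun (_ : ι) (_ : κ) => μ)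
  refine h.trans ?_
  congr 1
  ext1 i
  exact (Measure.map_infinitePi_infinitePi_of_inj (P := fun _ : ι × κ => μ)
    (f := fun j : κ => (i, j)) (fun _ _ h => (Prod.ext_iff.1 h).2)).symm

theorem hasLaw_eval_infinitePi {ι : Type*} {X : ι → Type*} [∀ i, MeasurableSpace (X i)]
    (μ : ∀ i, Measure (X i)) [∀ i, IsProbabilityMeasure (μ i)] (i : ι) :
    HasLaw (fun ω : ∀ i, X i => ω i) (μ i) (Measure.infinitePi μ) :=
  ⟨(measurable_pi_apply i).aemeasurable, Measure.infinitePi_map_eval μ i⟩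

theorem indepFun_eval_infinitePi {ι : Type*} {X : ι → Type*} [∀ i, MeasurableSpace (X i)]
    (μ : ∀ i, Measure (X i)) [∀ i, IsProbabilityMeasure (μ i)] {i j : ι} (h : i ≠ j) :
    IndepFun (fun ω : ∀ i, X i => ω i) (fun ω => ω j) (Measure.infinitePi μ) :=
  (iIndepFun_infinitePi (P := μ) (X := fun _ x => x) (fun _ => measurable_id)).indepFun h

/-! ### The laws of rewards and noise, and the independence of a time step from its past. -/

namespace TSExplore

variable {m : ℕ}

/-- The law of the table of rewards. -/
noncomputable def rewardLaw (D : Fin m → ProbabilityMeasure ℝ) : Measure (Fin m × ℕ → ℝ) :=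
  Measure.infinitePi fun p : Fin m × ℕ => (D p.1 : Measure ℝ)

/-- The law of the table of noise variables. -/
noncomputable def noiseLaw (m : ℕ) : Measure (ℕ × ℕ × Fin m → ℝ) :=
  Measure.infinitePi fun _ : ℕ × ℕ × Fin m => gaussianReal 0 1

/-- The law of the noise variables of one time step. -/
noncomputable def rowLaw (m : ℕ) : Measure (ℕ × Fin m → ℝ) :=
  Measure.infinitePi fun _ : ℕ × Fin m => gaussianReal 0 1

instance (D : Fin m → ProbabilityMeasure ℝ) : IsProbabilityMeasure (rewardLaw D) := by
  unfold rewardLaw; infer_instance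

instance : IsProbabilityMeasure (noiseLaw m) := by unfold noiseLaw; infer_instance

instance : IsProbabilityMeasure (rowLaw m) := by unfold rowLaw; infer_instance

theorem law_eq (D : Fin m → ProbabilityMeasure ℝ) : law D = (rewardLaw D).prod (noiseLaw m) := rfl

instance (D : Fin m → ProbabilityMeasure ℝ) : IsProbabilityMeasure (law D) := by
  rw [law_eq]; infer_instance

theorem law_fst_mem (D : Fin m → ProbabilityMeasure ℝ) (S : Set (Fin m × ℕ → ℝ)) :
    law D {ω | ω.1 ∈ S} = rewardLaw D S := by
  have h : {ω : Outcome m | ω.1 ∈ S} = S ×ˢ Set.univ := by ext; simp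
  rw [h, law_eq, Measure.prod_prod, measure_univ, mul_one]

theorem law_snd_mem (D : Fin m → ProbabilityMeasure ℝ) (S : Set (ℕ × ℕ × Fin m → ℝ)) :
    law D {ω | ω.2 ∈ S} = noiseLaw m S := by
  have h : {ω : Outcome m | ω.2 ∈ S} = Set.univ ×ˢ S := by ext; simp
  rw [h, law_eq, Measure.prod_prod, measure_univ, one_mul]

/-- The noise variables of time step `t`. -/
def row (t : ℕ) (ξ : ℕ × ℕ × Fin m → ℝ) (p : ℕ × Fin m) : ℝ := ξ (t, p)

/-- The noise variables before time step `t`; the others are replaced by `0`. -/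
noncomputable def past (t : ℕ) (ξ : ℕ × ℕ × Fin m → ℝ) (p : ℕ × ℕ × Fin m) : ℝ :=
  if p.1 < t then ξ p else 0

theorem measurable_row (t : ℕ) : Measurable (row (m := m) t) :=
  measurable_pi_lambda _ fun p => measurable_pi_apply (t, p)

theorem noiseLaw_map_row (t : ℕ) : (noiseLaw m).map (row t) = rowLaw m :=
  Measure.map_infinitePi_infinitePi_of_inj (P := fun _ : ℕ × ℕ × Fin m => gaussianReal 0 1)
    (f := fun p : ℕ × Fin m => (t, p)) (fun _ _ h => (Prod.ext_iff.1 h).2)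

/-- `past t` is measurable with respect to the rows before `t`, and these are jointly independent of
row `t`. -/
theorem indepFun_past_row (t : ℕ) : IndepFun (past t) (row t) (noiseLaw m) := by
  have h1 : iIndepFun (row (m := m)) (noiseLaw m) := iIndepFun_rows_infinitePi (gaussianReal 0 1)
  have h2 := indep_iSup_of_disjoint (S := Set.Iio t) (T := {t})
    (fun s => (measurable_row (m := m) s).comap_le) h1.iIndep (by simp)
  rw [IndepFun_iff_Indep]
  refine indep_of_indep_of_le_left (indep_of_indep_of_le_right h2 ?_) ?_
  · exact le_iSup₂_of_le t rfl le_rfl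
  · refine measurable_iff_comap_le.1 ?_
    refine (@measurable_pi_iff _ _ _ (⨆ s ∈ Set.Iio t, MeasurableSpace.comap (row s) inferInstance)
      _ _).2 fun p => ?_
    unfold past
    split_ifs with h
    · have h3 : Measurable[MeasurableSpace.comap (row (m := m) p.1) inferInstance]
          fun ξ : ℕ × ℕ × Fin m → ℝ => ξ p :=
        (measurable_pi_apply p.2).comp (comap_measurable (row (m := m) p.1))
      exact h3.mono (le_iSup₂_of_le (f := fun s (_ : s ∈ Set.Iio t) =>
        MeasurableSpace.comap (row (m := m) s) inferInstance) p.1 h le_rfl) le_rfl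
    · exact measurable_const

theorem law_inter_row (D : Fin m → ProbabilityMeasure ℝ) (t : ℕ) {A : Set (Outcome m)}
    (hA : MeasurableSet A) (hAp : ∀ ω, ω ∈ A ↔ (ω.1, past t ω.2) ∈ A)
    {B : Set (ℕ × Fin m → ℝ)} (hB : MeasurableSet B) :
    law D (A ∩ {ω | row t ω.2 ∈ B}) = law D A * rowLaw m B := by
  have hB' : MeasurableSet {ω : Outcome m | row t ω.2 ∈ B} :=
    ((measurable_row t).comp measurable_snd) hB
  rw [law_eq, Measure.prod_apply (hA.inter hB'), Measure.prod_apply hA,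
    ← lintegral_mul_const _ (measurable_measure_prodMk_left hA)]
  refine lintegral_congr fun X => ?_
  have h1 : Prod.mk X ⁻¹' A = past t ⁻¹' (Prod.mk X ⁻¹' A) := by
    ext ξ
    exact hAp (X, ξ)
  have h2 : Prod.mk X ⁻¹' (A ∩ {ω | row t ω.2 ∈ B}) = past t ⁻¹' (Prod.mk X ⁻¹' A) ∩ row t ⁻¹' B := by
    rw [← h1]; rfl
  rw [h2, (indepFun_past_row t).measure_inter_preimage_eq_mul _ _ (measurable_prodMk_left hA) hB,
    ← h1, ← noiseLaw_map_row t, Measure.map_apply (measurable_row t) hB]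

/-- If `Z` depends only on the rewards and on the noise before time `t`, then an event about the
noise at time `t` whose probability is at most `p` for every fixed value of `Z` has probability at
most `p`. -/
theorem law_row_mem_le (D : Fin m → ProbabilityMeasure ℝ) (t : ℕ) {V : Type*} [Countable V]
    [MeasurableSpace V] [MeasurableSingletonClass V] {Z : Outcome m → V} (hZ : Measurable Z)
    (hZp : ∀ ω, Z ω = Z (ω.1, past t ω.2)) {B : V → Set (ℕ × Fin m → ℝ)}
    (hB : ∀ v, MeasurableSet (B v)) {p : ENNReal} (hp : ∀ v, rowLaw m (B v) ≤ p) :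
    law D {ω | row t ω.2 ∈ B (Z ω)} ≤ p := by
  -- Splitting over the countably many values of `Z` takes the place of conditioning on the past.
  -- The weights sum to at most one, so no union bound over the values is paid.
  have h1 : {ω | row t ω.2 ∈ B (Z ω)} = ⋃ v, (Z ⁻¹' {v} ∩ {ω | row t ω.2 ∈ B v}) := by
    ext ω
    simp
  rw [h1]
  calc _ ≤ ∑' v, law D (Z ⁻¹' {v} ∩ {ω | row t ω.2 ∈ B v}) := measure_iUnion_le _
    _ ≤ ∑' v, law D (Z ⁻¹' {v}) * p := by
      refine ENNReal.tsum_le_tsum fun v => ?_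
      rw [law_inter_row D t (hZ (measurableSet_singleton v)) ?_ (hB v)]
      · gcongr
        exact hp v
      · intro ω
        simp only [Set.mem_preimage, Set.mem_singleton_iff]
        rw [← hZp]
    _ = (∑' v, law D (Z ⁻¹' {v})) * p := ENNReal.tsum_mul_right
    _ ≤ 1 * p := by
      gcongr
      rw [← measure_iUnion _ fun v => hZ (measurableSet_singleton v)]
      · exact prob_le_one
      · exact fun v w hvw => Set.disjoint_left.2 fun ω h h' => hvw (h.symm.trans h')
    _ = p := one_mul p

/-! ### Probabilities of events about rewards and noise -/

theorem rowLaw_forall_lt {a b : Fin m} (hab : a ≠ b) {α : ℝ} (hα : α ≠ 0) (β y : ℝ) (M : ℕ) :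
    rowLaw m {x | ∀ k < M, α * x (k, a) - β * x (k, b) < y * √(α ^ 2 + β ^ 2)}
      = ENNReal.ofReal ((1 - gaussTail y) ^ M) := by
  have h1 := iIndepFun_rows_infinitePi (ι := ℕ) (κ := Fin m) (gaussianReal 0 1)
  have hS : MeasurableSet {z : Fin m → ℝ | α * z a - β * z b < y * √(α ^ 2 + β ^ 2)} :=
    measurableSet_lt (by fun_prop) (by fun_prop)
  have h2 := h1.measure_inter_preimage_eq_mul (Finset.range M)
    (sets := fun _ => {z : Fin m → ℝ | α * z a - β * z b < y * √(α ^ 2 + β ^ 2)})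
    (fun _ _ => hS)
  have h3 : {x : ℕ × Fin m → ℝ | ∀ k < M, α * x (k, a) - β * x (k, b) < y * √(α ^ 2 + β ^ 2)}
      = ⋂ k ∈ Finset.range M, (fun (ω : ℕ × Fin m → ℝ) (j : Fin m) => ω (k, j)) ⁻¹'
        {z : Fin m → ℝ | α * z a - β * z b < y * √(α ^ 2 + β ^ 2)} := by
    ext x
    simp
  have h4 : ∀ k : ℕ, rowLaw m ((fun (ω : ℕ × Fin m → ℝ) (j : Fin m) => ω (k, j)) ⁻¹'
        {z : Fin m → ℝ | α * z a - β * z b < y * √(α ^ 2 + β ^ 2)})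
      = ENNReal.ofReal (1 - gaussTail y) := by
    intro k
    have h5 := measureReal_le_mul_sub_mul
      (hasLaw_eval_infinitePi (fun _ : ℕ × Fin m => gaussianReal 0 1) (k, a))
      (hasLaw_eval_infinitePi (fun _ : ℕ × Fin m => gaussianReal 0 1) (k, b))
      (indepFun_eval_infinitePi (fun _ : ℕ × Fin m => gaussianReal 0 1)
        (fun h => hab (Prod.ext_iff.1 h).2)) (b := β) hα y
    have h6 : (fun (ω : ℕ × Fin m → ℝ) (j : Fin m) => ω (k, j)) ⁻¹'
        {z : Fin m → ℝ | α * z a - β * z b < y * √(α ^ 2 + β ^ 2)}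
        = {x : ℕ × Fin m → ℝ | y * √(α ^ 2 + β ^ 2) ≤ α * x (k, a) - β * x (k, b)}ᶜ := by
      ext x
      simp
    rw [h6, ← h5, ← ofReal_measureReal (μ := rowLaw m)]
    congr 1
    exact probReal_compl_eq_one_sub (measurableSet_le (by fun_prop) (by fun_prop))
  rw [h3]
  refine h2.trans ?_
  refine (Finset.prod_congr rfl fun k _ => h4 k).trans ?_
  rw [Finset.prod_const, Finset.card_range, ENNReal.ofReal_pow]
  rw [sub_nonneg]
  exact measureReal_le_one

theorem law_exists_lt_abs_noise_le (D : Fin m → ProbabilityMeasure ℝ) (t M : ℕ) {s : ℝ}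
    (hs : 0 ≤ s) : law D {ω | ∃ k < M, ∃ i, s < |ω.2 (t, k, i)|}
      ≤ ENNReal.ofReal (M * m * (2 * Real.exp (-s ^ 2 / 2))) := by
  rw [← ofReal_measureReal]
  refine ENNReal.ofReal_le_ofReal ?_
  have h1 : {ω : Outcome m | ∃ k < M, ∃ i, s < |ω.2 (t, k, i)|}
      = ⋃ p ∈ Finset.range M ×ˢ (Finset.univ : Finset (Fin m)),
        {ω : Outcome m | s < |ω.2 (t, p)|} := by
    ext ω
    simp
  have h2 : ∀ p : ℕ × Fin m, (law D).real {ω : Outcome m | s < |ω.2 (t, p)|}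
      ≤ 2 * Real.exp (-s ^ 2 / 2) := by
    intro p
    have h3 := measureReal_lt_abs_le_of_hasLaw_gaussianReal
      (hasLaw_eval_infinitePi (fun _ : ℕ × ℕ × Fin m => gaussianReal 0 1) (t, p)) hs
    have h4 := law_snd_mem D {ξ | s < |ξ (t, p)|}
    rw [measureReal_def] at h3 ⊢
    exact (congrArg ENNReal.toReal h4).trans_le h3
  rw [h1]
  refine (measureReal_biUnion_finset_le _ _).trans ((Finset.sum_le_sum fun p _ => h2 p).trans ?_)
  simp [Finset.card_product]

/-- For fixed rewards the left side is a normal variable without atoms; `α ≠ 0` alone keeps its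
variance positive. -/
theorem law_noise_tie_eq_zero (D : Fin m → ProbabilityMeasure ℝ) {p p' : ℕ × ℕ × Fin m}
    (hp : p ≠ p') {α : ℝ} (hα : α ≠ 0) (β : ℝ) {f : (Fin m × ℕ → ℝ) → ℝ} (hf : Measurable f) :
    law D {ω | α * ω.2 p - β * ω.2 p' = f ω.1} = 0 := by
  have h1 : MeasurableSet {ω : Outcome m | α * ω.2 p - β * ω.2 p' = f ω.1} :=
    measurableSet_eq_fun (by fun_prop) (by fun_prop)
  rw [law_eq, Measure.prod_apply h1]
  refine (lintegral_congr fun X => ?_).trans lintegral_zero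
  exact measure_mul_sub_mul_eq_const
    (hasLaw_eval_infinitePi (fun _ : ℕ × ℕ × Fin m => gaussianReal 0 1) p)
    (hasLaw_eval_infinitePi (fun _ : ℕ × ℕ × Fin m => gaussianReal 0 1) p')
    (indepFun_eval_infinitePi (fun _ : ℕ × ℕ × Fin m => gaussianReal 0 1) hp) hα (f X)

/-- Hoeffding's inequality: a centred variable with values in an interval of length one is
sub-Gaussian with parameter `1/4`, and the parameters of independent variables add. -/
theorem law_lt_abs_sum_sub_le {D : Fin m → ProbabilityMeasure ℝ}
    (hD : ∀ i, (D i : Measure ℝ) (Set.Icc 0 1)ᶜ = 0) (i : Fin m) (k : ℕ) {s : ℝ} (hs : 0 ≤ s) :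
    law D {ω | s < |∑ l ∈ Finset.range k, ω.1 (i, l) - k * mean D i|}
      ≤ ENNReal.ofReal (2 * Real.exp (-2 * s ^ 2 / k)) := by
  have h1 : HasSubgaussianMGF (fun x => x - mean D i) ((‖(1 : ℝ) - 0‖₊ / 2) ^ 2)
      (D i : Measure ℝ) := by
    refine hasSubgaussianMGF_of_mem_Icc (X := fun x : ℝ => x) (by fun_prop) ?_
    rw [ae_iff]
    exact hD i
  have h2 : ∀ l : ℕ, HasSubgaussianMGF (fun X : Fin m × ℕ → ℝ => X (i, l) - mean D i)
      ((‖(1 : ℝ) - 0‖₊ / 2) ^ 2) (rewardLaw D) := by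
    intro l
    have h3 := hasLaw_eval_infinitePi (fun p : Fin m × ℕ => (D p.1 : Measure ℝ)) (i, l)
    exact HasSubgaussianMGF.of_map h3.aemeasurable (by rw [h3.map_eq]; exact h1)
  have h4 : iIndepFun (fun (l : ℕ) (X : Fin m × ℕ → ℝ) => X (i, l) - mean D i) (rewardLaw D) :=
    (iIndepFun_infinitePi (P := fun p : Fin m × ℕ => (D p.1 : Measure ℝ))
      (X := fun _ x => x - mean D i) (fun _ => by fun_prop)).precomp
        (g := fun l : ℕ => (i, l)) (fun _ _ h => (Prod.ext_iff.1 h).2)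
  have h5 := HasSubgaussianMGF.sum_of_iIndepFun (s := Finset.range k) h4 (fun l _ => h2 l)
  have h6 := h5.measure_ge_le hs
  have h7 := h5.neg.measure_ge_le hs
  have h8 : -s ^ 2 / (2 * ((∑ _l ∈ Finset.range k, (‖(1 : ℝ) - 0‖₊ / 2) ^ 2 : NNReal) : ℝ))
      = -2 * s ^ 2 / k := by
    simp
    ring
  rw [h8] at h6 h7
  rw [show {ω : Outcome m | s < |∑ l ∈ Finset.range k, ω.1 (i, l) - k * mean D i|}
    = {ω | ω.1 ∈ {X : Fin m × ℕ → ℝ | s < |∑ l ∈ Finset.range k, X (i, l) - k * mean D i|}}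
    from rfl, law_fst_mem, ← ofReal_measureReal]
  refine ENNReal.ofReal_le_ofReal ?_
  rw [two_mul]
  refine (measureReal_mono ?_).trans ((measureReal_union_le _ _).trans (add_le_add h6 h7))
  intro X (hX : s < _)
  have h9 : ∑ l ∈ Finset.range k, (X (i, l) - mean D i)
      = ∑ l ∈ Finset.range k, X (i, l) - k * mean D i := by
    simp [Finset.sum_sub_distrib]
  simp only [Set.mem_union, Set.mem_ofPred_eq, Pi.neg_apply]
  rw [h9]
  rcases lt_abs.1 hX with h | h
  · exact Or.inl h.le
  · exact Or.inr h.le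

end TSExplore

/-- Needed because the algorithm evaluates random families at random arms and random sample indices.
-/
theorem measurable_apply_of_countable {Ω α β : Type*} [MeasurableSpace Ω] [MeasurableSpace α]
    [Countable α] [MeasurableSingletonClass α] [MeasurableSpace β] {f : Ω → α → β} {g : Ω → α}
    (hf : ∀ a, Measurable fun ω => f ω a) (hg : Measurable g) : Measurable fun ω => f ω (g ω) := by
  have h : Measurable fun p : α × Ω => f p.2 p.1 := measurable_from_prod_countable_right hf
  exact h.comp (hg.prodMk measurable_id)

namespace TSExplore

variable {m : ℕ} (r : Rules m) (δ q : ℝ)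

/-! ### One step of the algorithm -/

/-- The empirically best arm. -/
noncomputable def State.best (s : State m) : Fin m := r.oracle s.empMean

/-- The best arm under the `k`-th sample at time `t`. -/
noncomputable def State.cand (s : State m) (ξ : ℕ × ℕ × Fin m → ℝ) (t k : ℕ) : Fin m :=
  r.oracle (s.sample δ q ξ t k)

/-- The advantage of the best arm of the `k`-th sample over the empirically best arm. -/
noncomputable def State.diff (s : State m) (ξ : ℕ × ℕ × Fin m → ℝ) (t k : ℕ) : ℝ :=
  s.sample δ q ξ t k (s.cand r δ q ξ t k) - s.sample δ q ξ t k (s.best r)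

/-- The index of the sample with the largest advantage. -/
noncomputable def State.argmaxDiff (s : State m) (ξ : ℕ × ℕ × Fin m → ℝ) (t : ℕ) : ℕ :=
  r.argmaxIdx (numSamples m δ q t) (s.diff r δ q ξ t)

/-- The arm to be pulled unless the algorithm stops. -/
noncomputable def State.next (s : State m) (ξ : ℕ × ℕ × Fin m → ℝ) (t : ℕ) : Fin m :=
  r.leastPulled s.N (symmDiff {s.best r} {s.cand r δ q ξ t (s.argmaxDiff r δ q ξ t)})

theorem step_of_out_ne_none (ω : Outcome m) (t : ℕ) (s : State m) (h : s.out ≠ none) :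
    step r δ q ω t s = s := by
  unfold step
  rw [if_pos h]

theorem step_of_forall (ω : Outcome m) (t : ℕ) (s : State m) (h : s.out = none)
    (hc : ∀ k < numSamples m δ q t, s.cand r δ q ω.2 t k = s.best r) :
    step r δ q ω t s = { s with out := some (s.best r) } := by
  unfold step
  rw [if_neg (not_not.2 h)]
  exact if_pos hc

theorem step_of_not_forall (ω : Outcome m) (t : ℕ) (s : State m) (h : s.out = none)
    (hc : ¬ ∀ k < numSamples m δ q t, s.cand r δ q ω.2 t k = s.best r) :
    step r δ q ω t s = s.pull ω.1 (s.next r δ q ω.2 t) := by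
  unfold step
  rw [if_neg (not_not.2 h)]
  exact if_neg hc

theorem run_succ (ω : Outcome m) (n : ℕ) :
    run r δ q ω (n + 1) = step r δ q ω (m + n + 1) (run r δ q ω n) := rfl

/-- A step leaves the counts unchanged, or it pulls an arm. -/
theorem step_cases (ω : Outcome m) (t : ℕ) (s : State m) :
    ((step r δ q ω t s).N = s.N ∧ (step r δ q ω t s).R = s.R) ∨
      step r δ q ω t s = s.pull ω.1 (s.next r δ q ω.2 t) := by
  by_cases h : s.out = none
  · by_cases hc : ∀ k < numSamples m δ q t, s.cand r δ q ω.2 t k = s.best r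
    · rw [step_of_forall r δ q ω t s h hc]
      exact Or.inl ⟨rfl, rfl⟩
    · exact Or.inr (step_of_not_forall r δ q ω t s h hc)
  · rw [step_of_out_ne_none r δ q ω t s h]
    exact Or.inl ⟨rfl, rfl⟩

theorem pull_N_apply (s : State m) (X : Fin m × ℕ → ℝ) (j i : Fin m) :
    (s.pull X j).N i = if i = j then s.N i + 1 else s.N i := by
  unfold State.pull
  by_cases h : i = j
  · subst h; simp
  · simp [h]

theorem sum_pull_N (s : State m) (X : Fin m × ℕ → ℝ) (j : Fin m) :
    ∑ i, (s.pull X j).N i = ∑ i, s.N i + 1 := by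
  simp_rw [pull_N_apply]
  rw [← Finset.sum_erase_add _ _ (Finset.mem_univ j),
    ← Finset.sum_erase_add (Finset.univ) s.N (Finset.mem_univ j), if_pos rfl, add_assoc]
  congr 1
  exact Finset.sum_congr rfl fun i hi => if_neg (Finset.ne_of_mem_erase hi)

/-! ### Invariants of the run -/

theorem run_N_pos (ω : Outcome m) (n : ℕ) (i : Fin m) : 0 < (run r δ q ω n).N i := by
  induction n with
  | zero => exact Nat.one_pos
  | succ n ih =>
    rw [run_succ]
    rcases step_cases r δ q ω (m + n + 1) (run r δ q ω n) with ⟨h, -⟩ | h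
    · rwa [h]
    · rw [h, pull_N_apply]
      split_ifs <;> omega

theorem run_N_le (ω : Outcome m) (n : ℕ) (i : Fin m) : (run r δ q ω n).N i ≤ n + 1 := by
  induction n with
  | zero => exact le_rfl
  | succ n ih =>
    rw [run_succ]
    rcases step_cases r δ q ω (m + n + 1) (run r δ q ω n) with ⟨h, -⟩ | h
    · rw [h]; omega
    · rw [h, pull_N_apply]
      split_ifs <;> omega

/-- Rewards are indexed by pull number, so adaptively collected data are initial segments of fixed
sequences. Concentration is thus needed only for deterministic lengths. -/
theorem run_R (ω : Outcome m) (n : ℕ) (i : Fin m) :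
    (run r δ q ω n).R i = ∑ l ∈ Finset.range ((run r δ q ω n).N i), ω.1 (i, l) := by
  induction n with
  | zero => simp [run, initState]
  | succ n ih =>
    rw [run_succ]
    rcases step_cases r δ q ω (m + n + 1) (run r δ q ω n) with ⟨h, h'⟩ | h
    · rw [h, h', ih]
    · rw [h, pull_N_apply]
      split_ifs with hi
      · rw [Finset.sum_range_succ, ← ih, hi]
        simp [State.pull]
      · rw [← ih]
        simp [State.pull, hi]

theorem out_eq_none_of_succ (ω : Outcome m) (n : ℕ) (h : (run r δ q ω (n + 1)).out = none) :
    (run r δ q ω n).out = none := by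
  by_contra h'
  rw [run_succ, step_of_out_ne_none r δ q ω _ _ h'] at h
  exact h' h

theorem run_succ_of_out_eq_none (ω : Outcome m) (n : ℕ)
    (h : (run r δ q ω (n + 1)).out = none) :
    run r δ q ω (n + 1) =
      (run r δ q ω n).pull ω.1 ((run r δ q ω n).next r δ q ω.2 (m + n + 1)) := by
  have h0 := out_eq_none_of_succ r δ q ω n h
  rw [run_succ] at h ⊢
  refine step_of_not_forall r δ q ω _ _ h0 fun hc => ?_
  rw [step_of_forall r δ q ω _ _ h0 hc] at h
  exact absurd h (by simp)

/-- Until it stops, the algorithm pulls exactly one arm in each iteration; bounding the complexity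
is bounding the duration. -/
theorem sum_run_N (ω : Outcome m) (n : ℕ) (h : (run r δ q ω n).out = none) :
    ∑ i, (run r δ q ω n).N i = m + n := by
  induction n with
  | zero => simp [run, initState]
  | succ n ih =>
    rw [run_succ_of_out_eq_none r δ q ω n h, sum_pull_N,
      ih (out_eq_none_of_succ r δ q ω n h), add_assoc]

/-! ### Dependence on the past -/

theorem step_past (ω : Outcome m) {t t' : ℕ} (ht : t < t') (s : State m) :
    step r δ q (ω.1, past t' ω.2) t s = step r δ q ω t s := by
  have h1 : ∀ k, s.sample δ q (past t' ω.2) t k = s.sample δ q ω.2 t k := by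
    intro k
    ext i
    simp [State.sample, past, ht]
  unfold step
  simp only [h1]

/-- The state at the start of a time step has not read the noise of that step; this is the
hypothesis `hZp` of `law_row_mem_le`. -/
theorem run_past (ω : Outcome m) (n : ℕ) {t : ℕ} (ht : m + n < t) :
    run r δ q (ω.1, past t ω.2) n = run r δ q ω n := by
  induction n with
  | zero => rfl
  | succ n ih =>
    rw [run_succ, run_succ, ih (by omega), step_past r δ q ω (by omega)]

/-! ### Measurability of the run -/

theorem measurable_run_aux {s : Outcome m → State m} (hN : Measurable fun ω => (s ω).N)
    (hR : Measurable fun ω => (s ω).R) (t : ℕ) :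
    (Measurable fun ω => (s ω).best r) ∧
    (∀ k, Measurable fun ω => (s ω).cand r δ q ω.2 t k) ∧
    Measurable fun ω => (s ω).next r δ q ω.2 t := by
  have hNi : ∀ i, Measurable fun ω => ((s ω).N i : ℝ) := fun i =>
    (measurable_of_countable (fun n : ℕ => (n : ℝ))).comp ((measurable_pi_apply i).comp hN)
  have hE : ∀ i, Measurable fun ω => (s ω).empMean i := fun i =>
    ((measurable_pi_apply i).comp hR).div (hNi i)
  have hb : Measurable fun ω => (s ω).best r :=
    r.measurable_oracle.comp (measurable_pi_lambda _ hE)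
  have hθ : ∀ k i, Measurable fun ω => (s ω).sample δ q ω.2 t k i := fun k i =>
    (hE i).add (((measurable_const.div (hNi i)).sqrt).mul
      ((measurable_pi_apply (t, k, i)).comp measurable_snd))
  have hc : ∀ k, Measurable fun ω => (s ω).cand r δ q ω.2 t k := fun k =>
    r.measurable_oracle.comp (measurable_pi_lambda _ (hθ k))
  have hd : ∀ k, Measurable fun ω => (s ω).diff r δ q ω.2 t k := fun k =>
    (measurable_apply_of_countable (hθ k) (hc k)).sub (measurable_apply_of_countable (hθ k) hb)
  have hk : Measurable fun ω => (s ω).argmaxDiff r δ q ω.2 t :=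
    (r.measurable_argmaxIdx _).comp (measurable_pi_lambda _ hd)
  have hck : Measurable fun ω => (s ω).cand r δ q ω.2 t ((s ω).argmaxDiff r δ q ω.2 t) :=
    measurable_apply_of_countable hc hk
  refine ⟨hb, hc, ?_⟩
  exact (measurable_of_countable fun p : (Fin m → ℕ) × Fin m × Fin m =>
    r.leastPulled p.1 (symmDiff {p.2.1} {p.2.2})).comp (hN.prodMk (hb.prodMk hck))

/-- The induction has to carry the event of not having stopped, since it decides whether counts and
sums are updated. Which arm is output plays no role. -/
theorem measurable_run (n : ℕ) :
    (Measurable fun ω => (run r δ q ω n).N) ∧ (Measurable fun ω => (run r δ q ω n).R) ∧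
      MeasurableSet {ω | (run r δ q ω n).out = none} := by
  induction n with
  | zero =>
    refine ⟨measurable_const, measurable_pi_lambda _ fun i => ?_, ?_⟩
    · exact (measurable_pi_apply (i, 0)).comp measurable_fst
    · simp [run, initState]
  | succ n ih =>
    obtain ⟨hN, hR, ho⟩ := ih
    obtain ⟨hb, hc, hn⟩ := measurable_run_aux r δ q hN hR (m + n + 1)
    have hS : MeasurableSet {ω | (run r δ q ω n).out = none ∧
        ¬ ∀ k < numSamples m δ q (m + n + 1),
          (run r δ q ω n).cand r δ q ω.2 (m + n + 1) k = (run r δ q ω n).best r} := by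
      have h : MeasurableSet (⋂ k, ⋂ (_ : k < numSamples m δ q (m + n + 1)),
          {ω | (run r δ q ω n).cand r δ q ω.2 (m + n + 1) k = (run r δ q ω n).best r}) :=
        MeasurableSet.iInter fun k => MeasurableSet.iInter fun _ =>
          measurableSet_eq_fun (hc k) hb
      convert ho.inter h.compl using 1
      ext
      simp
    set S := {ω | (run r δ q ω n).out = none ∧
        ¬ ∀ k < numSamples m δ q (m + n + 1),
          (run r δ q ω n).cand r δ q ω.2 (m + n + 1) k = (run r δ q ω n).best r} with hSdef
    classical
    have hin : ∀ ω ∈ S, run r δ q ω (n + 1) =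
        (run r δ q ω n).pull ω.1 ((run r δ q ω n).next r δ q ω.2 (m + n + 1)) := fun ω hω =>
      step_of_not_forall r δ q ω _ _ hω.1 hω.2
    have hout : ∀ ω ∉ S, (run r δ q ω (n + 1)).N = (run r δ q ω n).N ∧
        (run r δ q ω (n + 1)).R = (run r δ q ω n).R ∧ (run r δ q ω (n + 1)).out ≠ none := by
      intro ω hω
      rw [run_succ]
      by_cases h : (run r δ q ω n).out = none
      · rw [step_of_forall r δ q ω _ _ h (by
          by_contra h'
          exact hω ⟨h, h'⟩)]
        simp
      · rw [step_of_out_ne_none r δ q ω _ _ h]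
        exact ⟨rfl, rfl, h⟩
    refine ⟨?_, ?_, ?_⟩
    · have h1 : (fun ω => (run r δ q ω (n + 1)).N) = fun ω => if ω ∈ S then
          Function.update (run r δ q ω n).N ((run r δ q ω n).next r δ q ω.2 (m + n + 1))
            ((run r δ q ω n).N ((run r δ q ω n).next r δ q ω.2 (m + n + 1)) + 1)
          else (run r δ q ω n).N := by
        ext1 ω
        split_ifs with h
        · rw [hin ω h]; rfl
        · exact (hout ω h).1
      rw [h1]
      exact Measurable.ite hS ((measurable_of_countable fun p : (Fin m → ℕ) × Fin m =>
        Function.update p.1 p.2 (p.1 p.2 + 1)).comp (hN.prodMk hn)) hN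
    · refine measurable_pi_lambda _ fun i => ?_
      have h1 : (fun ω => (run r δ q ω (n + 1)).R i) = fun ω => if ω ∈ S then
          (if (run r δ q ω n).next r δ q ω.2 (m + n + 1) = i then
            (run r δ q ω n).R i + ω.1 (i, (run r δ q ω n).N i) else (run r δ q ω n).R i)
          else (run r δ q ω n).R i := by
        ext1 ω
        split_ifs with h h'
        · rw [hin ω h, h']; simp [State.pull]
        · rw [hin ω h]; simp [State.pull, Ne.symm h']
        · rw [(hout ω h).2.1]
      rw [h1]
      have hRi := (measurable_pi_apply i).comp hR
      refine Measurable.ite hS (Measurable.ite (hn (measurableSet_singleton i))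
        (hRi.add ?_) hRi) hRi
      exact measurable_apply_of_countable (f := fun (ω : Outcome m) (l : ℕ) => ω.1 (i, l))
        (fun l => (measurable_pi_apply (i, l)).comp measurable_fst)
        ((measurable_pi_apply i).comp hN)
    · convert hS using 1
      ext ω
      by_cases h : ω ∈ S
      · simp only [h, iff_true]
        change (run r δ q ω (n + 1)).out = none
        rw [hin ω h]
        exact h.1
      · simp only [h, iff_false]
        exact (hout ω h).2.2

theorem measurable_run_N_best (n : ℕ) :
    Measurable fun ω => ((run r δ q ω n).N, (run r δ q ω n).best r) := by
  obtain ⟨hN, hR, -⟩ := measurable_run r δ q n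
  exact hN.prodMk (measurable_run_aux r δ q hN hR 0).1

end TSExplore

namespace TSExplore

variable {m : ℕ}

/-! ### Gaps -/

section Gaps

variable {D : Fin m → ProbabilityMeasure ℝ} {a : Fin m}

theorem mean_mem_Icc (hD : IsInstance D a) (i : Fin m) : mean D i ∈ Set.Icc (0 : ℝ) 1 := by
  have h : ∀ᵐ x ∂(D i : Measure ℝ), x ∈ Set.Icc (0 : ℝ) 1 := by
    rw [ae_iff]; exact hD.1 i
  constructor
  · exact integral_nonneg_of_ae (h.mono fun x hx => hx.1)
  · have h1 : ∫ x, x ∂(D i : Measure ℝ) ≤ ∫ _, (1 : ℝ) ∂(D i : Measure ℝ) :=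
      integral_mono_ae (Integrable.of_mem_Icc 0 1 (by fun_prop) h) (integrable_const _)
        (h.mono fun x hx => hx.2)
    simpa [mean] using h1

theorem gap_of_ne {i : Fin m} (h : i ≠ a) : gap D a i = mean D a - mean D i := if_neg h

theorem gap_self_le {i : Fin m} (h : i ≠ a) : gap D a a ≤ gap D a i := by
  rw [gap_of_ne h, gap, if_pos rfl]
  have := le_ciSup (f := fun j : {j : Fin m // j ≠ a} => mean D j) (Set.finite_range _).bddAbove
    ⟨i, h⟩
  simp only at this
  linarith

theorem exists_ne_gap_self_eq (hm : 2 ≤ m) (a : Fin m) :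
    ∃ i, i ≠ a ∧ gap D a a = gap D a i := by
  have : Nontrivial (Fin m) := Fin.nontrivial_iff_two_le.2 hm
  obtain ⟨i, hi⟩ := exists_ne a
  have : Nonempty {j : Fin m // j ≠ a} := ⟨⟨i, hi⟩⟩
  obtain ⟨⟨j, hj⟩, h⟩ := exists_eq_ciSup_of_finite (f := fun j : {j : Fin m // j ≠ a} => mean D j)
  refine ⟨j, hj, ?_⟩
  rw [gap_of_ne hj, gap, if_pos rfl, ← h]

theorem gap_pos (hm : 2 ≤ m) (hD : IsInstance D a) (i : Fin m) : 0 < gap D a i := by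
  have h : ∀ i, i ≠ a → 0 < gap D a i := fun i hi => by
    rw [gap_of_ne hi]; linarith [hD.2 i hi]
  by_cases hi : i = a
  · obtain ⟨j, hj, hg⟩ := exists_ne_gap_self_eq (D := D) hm a
    rw [hi, hg]
    exact h j hj
  · exact h i hi

theorem gap_le_one (hm : 2 ≤ m) (hD : IsInstance D a) (i : Fin m) : gap D a i ≤ 1 := by
  have h : ∀ i, i ≠ a → gap D a i ≤ 1 := fun i hi => by
    rw [gap_of_ne hi]; linarith [(mean_mem_Icc hD a).2, (mean_mem_Icc hD i).1]
  by_cases hi : i = a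
  · obtain ⟨j, hj, hg⟩ := exists_ne_gap_self_eq (D := D) hm a
    rw [hi, hg]
    exact h j hj
  · exact h i hi

theorem le_hardness (hm : 2 ≤ m) (hD : IsInstance D a) : (m : ℝ) ≤ hardness D a := by
  have h : ∑ _i : Fin m, (1 : ℝ) ≤ hardness D a := by
    refine Finset.sum_le_sum fun i _ => ?_
    have h0 := gap_pos hm hD i
    rw [le_div_iff₀ (by positivity), one_mul]
    exact pow_le_one₀ h0.le (gap_le_one hm hD i)
  simpa using h

end Gaps

/-! ### The parameters -/

/-- `log (12 m² t² M / δ)`, where `M` is the number of samples drawn at time `t`. -/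
noncomputable def logSamples (m : ℕ) (δ q : ℝ) (t : ℕ) : ℝ :=
  Real.log (12 * (m : ℝ) ^ 2 * (t : ℝ) ^ 2 * numSamples m δ q t / δ)

theorem one_div_le_logTerm_arg {δ : ℝ} (hm : 2 ≤ m) (h0 : 0 < δ) {t : ℕ} (ht : 1 ≤ t) :
    1 / δ ≤ 12 * (m : ℝ) ^ 2 * (t : ℝ) ^ 2 / δ := by
  have h3 : (1 : ℝ) ≤ m := by exact_mod_cast (by omega : 1 ≤ m)
  have h4 : (1 : ℝ) ≤ t := by exact_mod_cast ht
  gcongr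
  nlinarith [one_le_pow₀ h3 (n := 2), one_le_pow₀ h4 (n := 2)]

theorem log_one_div_le_logTerm {δ : ℝ} (hm : 2 ≤ m) (h0 : 0 < δ) {t : ℕ} (ht : 1 ≤ t) :
    Real.log (1 / δ) ≤ logTerm m δ t :=
  Real.log_le_log (by positivity) (one_div_le_logTerm_arg hm h0 ht)

theorem logTerm_mono {δ : ℝ} (hm : 2 ≤ m) (h0 : 0 < δ) {t t' : ℕ} (ht : 1 ≤ t) (h : t ≤ t') :
    logTerm m δ t ≤ logTerm m δ t' := by
  have : (1 : ℝ) ≤ t := by exact_mod_cast ht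
  have h3 : (0 : ℝ) < m := by exact_mod_cast (by omega : 0 < m)
  unfold logTerm
  gcongr

theorem exp_neg_logTerm {δ : ℝ} (hm : 2 ≤ m) (h0 : 0 < δ) {t : ℕ} (ht : 1 ≤ t) :
    Real.exp (-logTerm m δ t) = δ / (12 * (m : ℝ) ^ 2 * (t : ℝ) ^ 2) := by
  have : (1 : ℝ) ≤ t := by exact_mod_cast ht
  have h3 : (0 : ℝ) < m := by exact_mod_cast (by omega : 0 < m)
  rw [logTerm, Real.exp_neg, Real.exp_log (by positivity), inv_div]

theorem numSamples_pos {δ q : ℝ} (hm : 2 ≤ m) (h0 : 0 < δ) (h1 : δ ≤ q) (h2 : q ≤ 1 / 10) {t : ℕ}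
    (ht : 1 ≤ t) : 0 < numSamples m δ q t := by
  have h3 := log_one_div_ge h0 (h1.trans h2)
  have h4 := log_one_div_le_logTerm hm h0 ht
  have h5 : 0 < q := h0.trans_le h1
  exact Nat.ceil_pos.2 (mul_pos (by positivity) (by linarith))

theorem logTerm_le_logSamples {δ q : ℝ} (hm : 2 ≤ m) (h0 : 0 < δ) (h1 : δ ≤ q) (h2 : q ≤ 1 / 10)
    {t : ℕ} (ht : 1 ≤ t) : logTerm m δ t ≤ logSamples m δ q t := by
  have h3 : (1 : ℝ) ≤ numSamples m δ q t := by exact_mod_cast numSamples_pos hm h0 h1 h2 ht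
  have : (1 : ℝ) ≤ t := by exact_mod_cast ht
  have h4 : (0 : ℝ) < m := by exact_mod_cast (by omega : 0 < m)
  unfold logTerm logSamples
  refine Real.log_le_log (by positivity) ?_
  refine (div_le_div_iff_of_pos_right h0).2 ?_
  exact le_mul_of_one_le_right (by positivity) h3

/-- Let `A` be the argument of the logarithm in `logTerm`. From `1/q ≤ 1/δ ≤ A` and `log A ≤ A - 1`,
the number of samples is at most `A (A - 1) + 1 ≤ A²`, so the larger logarithm is at most `log
(A³)`. -/
theorem logSamples_le {δ q : ℝ} (hm : 2 ≤ m) (h0 : 0 < δ) (h1 : δ ≤ q) (h2 : q ≤ 1 / 10)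
    {t : ℕ} (ht : 1 ≤ t) : logSamples m δ q t ≤ 3 * logTerm m δ t := by
  have hq : 0 < q := h0.trans_le h1
  have hA := one_div_le_logTerm_arg hm h0 ht
  have hMpos : (1 : ℝ) ≤ numSamples m δ q t := by exact_mod_cast numSamples_pos hm h0 h1 h2 ht
  have hL : 0 ≤ logTerm m δ t := by
    linarith [log_one_div_ge h0 (h1.trans h2), log_one_div_le_logTerm hm h0 ht]
  have hM : (numSamples m δ q t : ℝ) < 1 / q * logTerm m δ t + 1 :=
    Nat.ceil_lt_add_one (by positivity)
  set A := 12 * (m : ℝ) ^ 2 * (t : ℝ) ^ 2 / δ with hAdef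
  have hA0 : 0 < A := lt_of_lt_of_le (by positivity) hA
  have hLA : logTerm m δ t ≤ A - 1 := Real.log_le_sub_one_of_pos hA0
  have hqA : 1 / q ≤ A := (one_div_le_one_div_of_le h0 h1).trans hA
  have h3 : (numSamples m δ q t : ℝ) ≤ A ^ 2 := by
    have : 1 / q * logTerm m δ t ≤ A * (A - 1) := by gcongr
    have h10 : 10 ≤ 1 / q := by rw [le_div_iff₀ hq]; linarith
    nlinarith
  calc logSamples m δ q t = Real.log (A * numSamples m δ q t) := by
        rw [logSamples, hAdef]; congr 1; ring
    _ ≤ Real.log (A ^ 3) := by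
        refine Real.log_le_log (by positivity) ?_
        calc A * numSamples m δ q t ≤ A * A ^ 2 := by gcongr
          _ = A ^ 3 := by ring
    _ = 3 * logTerm m δ t := by rw [Real.log_pow]; rfl

/-! ### Steps under the good events -/

/-- The conditions on a state `s` at time `t` under which the step goes well: the empirical means
and the samples are accurate, the optimal arm beats a suboptimal empirical best arm in some sample
by a large margin, and there are no ties. -/
structure GoodStep (D : Fin m → ProbabilityMeasure ℝ) (a : Fin m) (r : Rules m) (δ q : ℝ)
    (ξ : ℕ × ℕ × Fin m → ℝ) (t : ℕ) (s : State m) : Prop where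
  empMean_sub_le : ∀ i, |s.empMean i - mean D i| ≤ √(logTerm m δ t / (2 * s.N i))
  noise_le : ∀ k < numSamples m δ q t, ∀ i, |ξ (t, k, i)| ≤ √(2 * logSamples m δ q t)
  exists_le : s.best r ≠ a → ∃ k < numSamples m δ q t,
    upperQuantile q * √(√(varParam m δ q t / s.N a) ^ 2 +
      √(varParam m δ q t / s.N (s.best r)) ^ 2) ≤ √(varParam m δ q t / s.N a) * ξ (t, k, a) -
        √(varParam m δ q t / s.N (s.best r)) * ξ (t, k, s.best r)
  sample_ne : ∀ k < numSamples m δ q t, ∀ i j, i ≠ j →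
    s.sample δ q ξ t k i ≠ s.sample δ q ξ t k j

section GoodStep

variable {D : Fin m → ProbabilityMeasure ℝ} {a : Fin m} {r : Rules m} {δ q : ℝ}
  {ξ : ℕ × ℕ × Fin m → ℝ} {t : ℕ} {s : State m}

/-- With `x = L / N a` and `y = L / N b`, the left side is the sum of two confidence radii and the
right side is the margin gained by the optimistic sample. -/
theorem sqrt_add_sqrt_le {x y : ℝ} (hx : 0 ≤ x) (hy : 0 ≤ y) :
    √(x / 2) + √(y / 2) ≤ √(x + y) := by
  refine Real.le_sqrt_of_sq_le ?_
  have h1 := Real.sq_sqrt (by positivity : 0 ≤ x / 2)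
  have h2 := Real.sq_sqrt (by positivity : 0 ≤ y / 2)
  nlinarith [sq_nonneg (√(x / 2) - √(y / 2))]

theorem varParam_nonneg (hL : 0 ≤ logTerm m δ t) : 0 ≤ varParam m δ q t :=
  div_nonneg hL (sq_nonneg _)

/-- In some sample the optimal arm beats the empirically best arm by at least the gap. -/
theorem GoodStep.exists_gap_le (hg : GoodStep D a r δ q ξ t s) (hL : 0 ≤ logTerm m δ t)
    (hφ : 0 < upperQuantile q) (hb : s.best r ≠ a) :
    ∃ k < numSamples m δ q t,
      gap D a (s.best r) ≤ s.sample δ q ξ t k a - s.sample δ q ξ t k (s.best r) := by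
  obtain ⟨k, hk, h⟩ := hg.exists_le hb
  refine ⟨k, hk, ?_⟩
  have hC := varParam_nonneg (q := q) hL
  set b := s.best r
  rw [Real.sq_sqrt (by positivity), Real.sq_sqrt (by positivity)] at h
  -- The factor `φ(q)` cancels the denominator of `varParam`, leaving a margin independent of `q`.
  have h1 : upperQuantile q * √(varParam m δ q t / s.N a + varParam m δ q t / s.N b)
      = √(logTerm m δ t / s.N a + logTerm m δ t / s.N b) := by
    nth_rw 1 [← Real.sqrt_sq hφ.le]
    rw [← Real.sqrt_mul (sq_nonneg _)]
    congr 1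
    unfold varParam
    field_simp
  have h2 := sqrt_add_sqrt_le (x := logTerm m δ t / s.N a) (y := logTerm m δ t / s.N b)
    (by positivity) (by positivity)
  have h3 := hg.empMean_sub_le a
  have h4 := hg.empMean_sub_le b
  rw [show logTerm m δ t / (2 * s.N a) = logTerm m δ t / s.N a / 2 by ring] at h3
  rw [show logTerm m δ t / (2 * s.N b) = logTerm m δ t / s.N b / 2 by ring] at h4
  rw [gap_of_ne hb]
  simp only [State.sample]
  linarith [(abs_le.1 h3).1, (abs_le.1 h4).2]

/-- If `b ≠ a`, then `b` loses strictly to `a` in some sample and cannot be the candidate there. -/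
theorem GoodStep.best_eq_of_forall_cand_eq (hm : 2 ≤ m) (hD : IsInstance D a)
    (hg : GoodStep D a r δ q ξ t s) (hL : 0 ≤ logTerm m δ t) (hφ : 0 < upperQuantile q)
    (hc : ∀ k < numSamples m δ q t, s.cand r δ q ξ t k = s.best r) : s.best r = a := by
  by_contra hb
  obtain ⟨k, hk, h⟩ := hg.exists_gap_le hL hφ hb
  have h1 := r.le_oracle (s.sample δ q ξ t k) a
  have h2 := hc k hk
  rw [State.cand] at h2
  rw [h2] at h1
  linarith [gap_pos hm hD (s.best r)]

/-- The pulled arm has the smaller count of `b` and the candidate `c`, so its radii `h` (means) and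
`ρ` (samples) control both arms. If `b = a`, the chosen sample ranks `c` above `a`, so the gap of
`c` is at most `2 (h + ρ)`. If `b ≠ a`, maximality of the chosen advantage gives `gap b ≤ θ c - θ
b`. For `b` this is at most `2 ρ`; for `c ≠ a`, adding `mean b - mean c` leaves only the deviations
of `θ` from the means. A pull of `a` itself is covered by `gap_self_le`. -/
theorem GoodStep.gap_next_le (hg : GoodStep D a r δ q ξ t s) (hL : 0 ≤ logTerm m δ t)
    (hφ : 0 < upperQuantile q) (hN : ∀ i, 0 < s.N i)
    (hc : ¬ ∀ k < numSamples m δ q t, s.cand r δ q ξ t k = s.best r) :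
    gap D a (s.next r δ q ξ t) ≤ 2 * (√(logTerm m δ t / (2 * s.N (s.next r δ q ξ t))) +
      √(varParam m δ q t / s.N (s.next r δ q ξ t)) * √(2 * logSamples m δ q t)) := by
  have hC := varParam_nonneg (q := q) hL
  have hM : 0 < numSamples m δ q t := by
    by_contra! h
    exact hc fun k hk => absurd hk (by omega)
  set b := s.best r with hb
  set k := s.argmaxDiff r δ q ξ t with hk
  set c := s.cand r δ q ξ t k with hcand
  have hkM : k < numSamples m δ q t := r.argmaxIdx_lt _ _ hM
  have hmax : ∀ l < numSamples m δ q t, s.diff r δ q ξ t l ≤ s.diff r δ q ξ t k :=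
    r.le_argmaxIdx _ _
  have hbest : ∀ i, s.empMean i ≤ s.empMean b := r.le_oracle s.empMean
  have hθ : ∀ l i, s.sample δ q ξ t l i ≤ s.sample δ q ξ t l (s.cand r δ q ξ t l) := fun l =>
    r.le_oracle (s.sample δ q ξ t l)
  have hdiff : s.diff r δ q ξ t k = s.sample δ q ξ t k c - s.sample δ q ξ t k b := rfl
  -- If the maximal advantage were that of `b` over itself, every advantage would be at most zero,
  -- and a sample with another candidate would contain a tie.
  have hcb : c ≠ b := by
    intro h
    push Not at hc
    obtain ⟨l, hl, hlb⟩ := hc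
    have h1 := hmax l hl
    rw [hdiff, h, sub_self, State.diff, sub_nonpos] at h1
    exact hg.sample_ne l hl _ _ hlb (le_antisymm h1 (hθ l _))
  have hsymm : symmDiff ({b} : Finset (Fin m)) {c} = {b, c} := by
    ext i
    simp only [Finset.mem_symmDiff, Finset.mem_singleton, Finset.mem_insert]
    constructor
    · rintro (h | h)
      · exact Or.inl h.1
      · exact Or.inr h.1
    · rintro (rfl | rfl)
      · exact Or.inl ⟨rfl, hcb.symm⟩
      · exact Or.inr ⟨rfl, hcb⟩
  set i := s.next r δ q ξ t with hi
  have hnext : i = r.leastPulled s.N {b, c} := by rw [hi, State.next, ← hsymm]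
  have himem : i = b ∨ i = c := by
    have h := r.leastPulled_mem s.N {b, c} (by simp)
    rw [← hnext] at h
    simpa using h
  have hmin : ∀ j, j = b ∨ j = c → s.N i ≤ s.N j := fun j hj => by
    rw [hnext]
    exact r.leastPulled_le s.N {b, c} j (by simpa using hj)
  have hi0 : (0 : ℝ) < s.N i := by exact_mod_cast hN i
  set h := √(logTerm m δ t / (2 * s.N i)) with hh
  set ρ := √(varParam m δ q t / s.N i) * √(2 * logSamples m δ q t) with hρ
  have hmean : ∀ j, j = b ∨ j = c → |s.empMean j - mean D j| ≤ h := fun j hj => by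
    refine (hg.empMean_sub_le j).trans (Real.sqrt_le_sqrt ?_)
    have : (s.N i : ℝ) ≤ s.N j := by exact_mod_cast hmin j hj
    gcongr
  have hsam : ∀ j, j = b ∨ j = c → |s.sample δ q ξ t k j - s.empMean j| ≤ ρ := fun j hj => by
    have : (s.N i : ℝ) ≤ s.N j := by exact_mod_cast hmin j hj
    rw [State.sample, add_sub_cancel_left, abs_mul, abs_of_nonneg (Real.sqrt_nonneg _)]
    refine mul_le_mul (Real.sqrt_le_sqrt ?_) (hg.noise_le k hkM j) (abs_nonneg _)
      (Real.sqrt_nonneg _)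
    gcongr
  have hh0 : 0 ≤ h := Real.sqrt_nonneg _
  have e1 := abs_le.1 (hmean b (Or.inl rfl))
  have e2 := abs_le.1 (hmean c (Or.inr rfl))
  have e3 := abs_le.1 (hsam b (Or.inl rfl))
  have e4 := abs_le.1 (hsam c (Or.inr rfl))
  have e5 : s.sample δ q ξ t k b ≤ s.sample δ q ξ t k c := hθ k b
  by_cases hba : b = a
  · have hca : c ≠ a := hba ▸ hcb
    have h1 : gap D a c ≤ 2 * (h + ρ) := by
      rw [gap_of_ne hca, ← hba]
      linarith
    rcases himem with hib | hic
    · rw [hib, hba]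
      exact (gap_self_le hca).trans h1
    · rwa [hic]
  · obtain ⟨l, hl, hgl⟩ := hg.exists_gap_le hL hφ hba
    have h1 : gap D a b ≤ s.sample δ q ξ t k c - s.sample δ q ξ t k b := by
      rw [← hdiff]
      refine le_trans ?_ (hmax l hl)
      rw [State.diff]
      linarith [hθ l a]
    -- `c` is empirically no better than `b`, so its lead in the sample comes from noise alone.
    have h2 : gap D a b ≤ 2 * (h + ρ) := by linarith [hbest c]
    rcases himem with hib | hic
    · rwa [hib]
    · rw [hic]
      by_cases hca : c = a
      · rw [hca]
        exact (gap_self_le hba).trans h2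
      · rw [gap_of_ne hca]
        rw [gap_of_ne hba] at h1
        linarith

/-- Squaring the gap bound via `(x + y)² ≤ 2 (x² + y²)` gives `n g² ≤ 4 L + 16 C S`, with `C ≤ 8 L /
l` and `S ≤ 3 L`. Since `l ≤ L`, the total is at most `388 L² / l`; `396` leaves slack. -/
theorem GoodStep.N_next_le (hm : 2 ≤ m) (hD : IsInstance D a) (h0 : 0 < δ) (h1 : δ ≤ q)
    (h2 : q ≤ 1 / 10) (ht : 1 ≤ t) (hg : GoodStep D a r δ q ξ t s) (hN : ∀ i, 0 < s.N i)
    (hc : ¬ ∀ k < numSamples m δ q t, s.cand r δ q ξ t k = s.best r) :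
    (s.N (s.next r δ q ξ t) : ℝ) ≤
      396 * logTerm m δ t ^ 2 / Real.log (1 / q) * (1 / gap D a (s.next r δ q ξ t) ^ 2) := by
  have hq : 0 < q := h0.trans_le h1
  have hl := log_one_div_ge hq h2
  have hlq : Real.log (1 / q) ≤ Real.log (1 / δ) :=
    Real.log_le_log (by positivity) (one_div_le_one_div_of_le h0 h1)
  have hlL := log_one_div_le_logTerm hm h0 ht
  have hL2 := logTerm_le_logSamples hm h0 h1 h2 ht
  have hL2' := logSamples_le hm h0 h1 h2 ht
  have hL : 0 < logTerm m δ t := by linarith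
  have hφ := upperQuantile_pos hq h2
  have hφ2 := log_le_upperQuantile_sq hq h2
  have hgap := hg.gap_next_le hL.le hφ hN hc
  have hgp := gap_pos hm hD (s.next r δ q ξ t)
  have hC := varParam_nonneg (q := q) hL.le
  set n : ℝ := ((s.N (s.next r δ q ξ t) : ℕ) : ℝ) with hn
  have hn0 : 0 < n := by rw [hn]; exact_mod_cast hN _
  set g := gap D a (s.next r δ q ξ t)
  set L := logTerm m δ t with hLdef
  set S := logSamples m δ q t
  set l := Real.log (1 / q)
  set x := √(L / (2 * n)) with hx
  set y := √(varParam m δ q t / n) * √(2 * S) with hy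
  have hx2 : x ^ 2 = L / (2 * n) := Real.sq_sqrt (by positivity)
  have hy2 : y ^ 2 = varParam m δ q t / n * (2 * S) := by
    rw [hy, mul_pow, Real.sq_sqrt (by positivity), Real.sq_sqrt (by linarith)]
  have hCle : varParam m δ q t ≤ 8 * L / l := by
    rw [varParam, ← hLdef, div_le_div_iff₀ (by positivity) (by linarith)]
    nlinarith
  have h3 : n * g ^ 2 ≤ 396 * L ^ 2 / l := by
    have h4 : g ^ 2 ≤ 8 * (x ^ 2 + y ^ 2) := by
      have h5 : g ^ 2 ≤ (2 * (x + y)) ^ 2 := by gcongr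
      nlinarith [sq_nonneg (x - y)]
    calc n * g ^ 2 ≤ n * (8 * (x ^ 2 + y ^ 2)) := by gcongr
      _ = 4 * L + 16 * (varParam m δ q t * S) := by rw [hx2, hy2]; field_simp; ring
      _ ≤ 4 * (L * L / l) + 16 * (8 * L / l * (3 * L)) := by
        have h6 : L ≤ L * L / l := by
          rw [le_div_iff₀ (by linarith)]
          nlinarith
        have h7 : varParam m δ q t * S ≤ 8 * L / l * (3 * L) := by
          refine mul_le_mul hCle hL2' (by linarith) ?_
          have : 0 < l := by linarith
          positivity
        linarith
      _ = 388 * (L ^ 2 / l) := by ring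
      _ ≤ 396 * (L ^ 2 / l) := by
        have : 0 < l := by linarith
        have : 0 ≤ L ^ 2 / l := by positivity
        linarith
      _ = _ := by ring
  rw [mul_one_div, le_div_iff₀ (by positivity)]
  exact h3

end GoodStep

/-! ### Runs under the good events -/

section GoodRun

variable {D : Fin m → ProbabilityMeasure ℝ} {a : Fin m} {r : Rules m} {δ q : ℝ} {ω : Outcome m}

/-- The count before an arm's latest pull obeys `GoodStep.N_next_le`, whose bound only grows with
time. The summand `1` pays for that pull, or for the initial one. -/
theorem run_N_le_of_good (hm : 2 ≤ m) (hD : IsInstance D a) (h0 : 0 < δ) (h1 : δ ≤ q)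
    (h2 : q ≤ 1 / 10) (hg : ∀ n, GoodStep D a r δ q ω.2 (m + n + 1) (run r δ q ω n)) (n : ℕ)
    (ho : (run r δ q ω n).out = none) (i : Fin m) :
    ((run r δ q ω n).N i : ℝ) ≤
      1 + 396 * logTerm m δ (m + n) ^ 2 / Real.log (1 / q) * (1 / gap D a i ^ 2) := by
  have hq : 0 < q := h0.trans_le h1
  have hl : 0 < Real.log (1 / q) := by linarith [log_one_div_ge hq h2]
  induction n with
  | zero =>
    simp only [run, initState, Nat.cast_one]
    have : 0 ≤ 396 * logTerm m δ (m + 0) ^ 2 / Real.log (1 / q) * (1 / gap D a i ^ 2) := by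
      positivity
    linarith
  | succ n ih =>
    have ho' := out_eq_none_of_succ r δ q ω n ho
    have hL0 : 0 ≤ logTerm m δ (m + n) := by
      linarith [log_one_div_ge h0 (h1.trans h2),
        log_one_div_le_logTerm hm h0 (by omega : 1 ≤ m + n)]
    have hmono := logTerm_mono hm h0 (by omega : 1 ≤ m + n) (by omega : m + n ≤ m + (n + 1))
    have hW : 396 * logTerm m δ (m + n) ^ 2 / Real.log (1 / q) * (1 / gap D a i ^ 2) ≤
        396 * logTerm m δ (m + (n + 1)) ^ 2 / Real.log (1 / q) * (1 / gap D a i ^ 2) := by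
      gcongr
    have hc : ¬ ∀ k < numSamples m δ q (m + n + 1),
        (run r δ q ω n).cand r δ q ω.2 (m + n + 1) k = (run r δ q ω n).best r := by
      intro hc
      rw [run_succ, step_of_forall r δ q ω _ _ ho' hc] at ho
      exact absurd ho (by simp)
    have h3 := (hg n).N_next_le hm hD h0 h1 h2 (by omega) (run_N_pos r δ q ω n) hc
    rw [run_succ_of_out_eq_none r δ q ω n ho, pull_N_apply]
    split_ifs with hi
    · rw [hi]
      push_cast
      rw [add_comm]
      gcongr
      exact h3
    · exact (ih ho').trans (by linarith)

theorem time_le_of_good (hm : 2 ≤ m) (hD : IsInstance D a) (h0 : 0 < δ) (h1 : δ ≤ q)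
    (h2 : q ≤ 1 / 10) (hg : ∀ n, GoodStep D a r δ q ω.2 (m + n + 1) (run r δ q ω n)) (n : ℕ)
    (ho : (run r δ q ω n).out = none) :
    ((m + n : ℕ) : ℝ) ≤
      m + 396 * logTerm m δ (m + n) ^ 2 / Real.log (1 / q) * hardness D a := by
  rw [← sum_run_N r δ q ω n ho, Nat.cast_sum]
  refine (Finset.sum_le_sum fun i _ => run_N_le_of_good hm hD h0 h1 h2 hg n ho i).trans ?_
  rw [sum_run_N r δ q ω n ho, Finset.sum_add_distrib, ← Finset.mul_sum]
  simp [hardness]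

/-- If a bound on the duration of the run holds as long as the algorithm has not stopped, then
the algorithm stops within that time, and its output is correct. -/
theorem mem_outputsWithin_of_good (hm : 2 ≤ m) (hD : IsInstance D a) (h0 : 0 < δ) (h1 : δ ≤ q)
    (h2 : q ≤ 1 / 10) (hg : ∀ n, GoodStep D a r δ q ω.2 (m + n + 1) (run r δ q ω n)) {B : ℝ}
    (hB : ∀ n, (run r δ q ω n).out = none → ((m + n : ℕ) : ℝ) ≤ B) :
    ω ∈ outputsWithin r δ q a B := by
  have hex : ∃ n, (run r δ q ω n).out ≠ none := by
    by_contra! h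
    obtain ⟨n, hn⟩ := exists_nat_gt B
    have := hB n (h n)
    push_cast at this
    linarith [(Nat.cast_nonneg m : (0 : ℝ) ≤ m)]
  classical
  -- The initial state has not stopped, so the first stopped state has a predecessor still running.
  -- The stopping step makes no observation, so the bound for that predecessor applies.
  obtain ⟨n, hn⟩ : ∃ n, Nat.find hex = n + 1 := by
    refine Nat.exists_eq_succ_of_ne_zero fun h => ?_
    have := Nat.find_spec hex
    rw [h] at this
    exact this rfl
  have hout := Nat.find_spec hex
  rw [hn] at hout
  have ho : (run r δ q ω n).out = none := by
    by_contra h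
    exact Nat.find_min hex (by omega) h
  have hL : 0 ≤ logTerm m δ (m + n + 1) := by
    linarith [log_one_div_ge h0 (h1.trans h2),
      log_one_div_le_logTerm hm h0 (by omega : 1 ≤ m + n + 1)]
  refine ⟨n + 1, ?_⟩
  by_cases hc : ∀ k < numSamples m δ q (m + n + 1),
      (run r δ q ω n).cand r δ q ω.2 (m + n + 1) k = (run r δ q ω n).best r
  · rw [run_succ, step_of_forall r δ q ω _ _ ho hc,
      (hg n).best_eq_of_forall_cand_eq hm hD hL (upperQuantile_pos (h0.trans_le h1) h2) hc]
    refine ⟨rfl, ?_⟩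
    change ((∑ i, (run r δ q ω n).N i : ℕ) : ℝ) ≤ B
    rw [sum_run_N r δ q ω n ho]
    exact hB n ho
  · rw [run_succ, step_of_not_forall r δ q ω _ _ ho hc] at hout
    exact absurd ho hout

end GoodRun

end TSExplore

namespace TSExplore

variable {m : ℕ} {D : Fin m → ProbabilityMeasure ℝ} {a : Fin m} {r : Rules m} {δ q : ℝ}

/-! ### The probability of the good events -/

/-- Some average of `n + 1` rewards of an arm is inaccurate. -/
def rewardFails (D : Fin m → ProbabilityMeasure ℝ) (δ : ℝ) (n : ℕ) : Set (Outcome m) :=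
  ⋃ i, {ω | √((n + 1 : ℕ) * logTerm m δ (n + 2) / 2) <
    |∑ l ∈ Finset.range (n + 1), ω.1 (i, l) - (n + 1 : ℕ) * mean D i|}

/-- Some noise variable used at time `m + n + 1` is large. -/
def noiseFails (m : ℕ) (δ q : ℝ) (n : ℕ) : Set (Outcome m) :=
  {ω | ∃ k < numSamples m δ q (m + n + 1), ∃ i,
    √(2 * logSamples m δ q (m + n + 1)) < |ω.2 (m + n + 1, k, i)|}

/-- The noise of one time step for which no sample favours arm `a` over arm `v.2` by a large margin,
if `v.1` are the counts. -/
def pairFails (δ q : ℝ) (a : Fin m) (t : ℕ) (v : (Fin m → ℕ) × Fin m) :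
    Set (ℕ × Fin m → ℝ) :=
  {x | (v.2 ≠ a ∧ 0 < v.1 a) ∧ ∀ k < numSamples m δ q t,
    √(varParam m δ q t / v.1 a) * x (k, a) - √(varParam m δ q t / v.1 v.2) * x (k, v.2) <
      upperQuantile q * √(√(varParam m δ q t / v.1 a) ^ 2 + √(varParam m δ q t / v.1 v.2) ^ 2)}

/-- At time `m + n + 1`, no sample favours arm `a` over the empirically best arm by a large
margin. -/
def optimismFails (r : Rules m) (δ q : ℝ) (a : Fin m) (n : ℕ) : Set (Outcome m) :=
  {ω | row (m + n + 1) ω.2 ∈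
    pairFails δ q a (m + n + 1) ((run r δ q ω n).N, (run r δ q ω n).best r)}

/-- Arms `i ≠ j` have the same value in sample `k` at time `t`, if they have been pulled `u` and `v`
times. -/
def tie (m : ℕ) (δ q : ℝ) (t k : ℕ) (i j : Fin m) (u v : ℕ) : Set (Outcome m) :=
  {ω | (i ≠ j ∧ 0 < u ∧ 0 < varParam m δ q t) ∧
    √(varParam m δ q t / u) * ω.2 (t, k, i) - √(varParam m δ q t / v) * ω.2 (t, k, j) =
      (∑ l ∈ Finset.range v, ω.1 (j, l)) / v - (∑ l ∈ Finset.range u, ω.1 (i, l)) / u}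

theorem law_tie_eq_zero (t k : ℕ) (i j : Fin m) (u v : ℕ) :
    law D (tie m δ q t k i j u v) = 0 := by
  by_cases h : i ≠ j ∧ 0 < u ∧ 0 < varParam m δ q t
  · have hu : (0 : ℝ) < u := by exact_mod_cast h.2.1
    have h1 := law_noise_tie_eq_zero D (p := (t, k, i)) (p' := (t, k, j))
      (by simpa using h.1) (Real.sqrt_pos.2 (div_pos h.2.2 hu)).ne' (√(varParam m δ q t / v))
      (f := fun X => (∑ l ∈ Finset.range v, X (j, l)) / v - (∑ l ∈ Finset.range u, X (i, l)) / u)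
      (by fun_prop)
    exact measure_mono_null (fun ω hω => hω.2) h1
  · exact measure_mono_null (fun ω hω => h hω.1) measure_empty

theorem law_rewardFails_le (hm : 2 ≤ m) (hD : IsInstance D a) (h0 : 0 < δ) (h1 : δ ≤ 1 / 10)
    (n : ℕ) : law D (rewardFails D δ n) ≤ ENNReal.ofReal (δ / 12 / ((n : ℝ) + 2) ^ 2) := by
  have hm2 : (2 : ℝ) ≤ m := by exact_mod_cast hm
  have hL : 0 ≤ logTerm m δ (n + 2) := by
    linarith [log_one_div_ge h0 h1, log_one_div_le_logTerm hm h0 (by omega : 1 ≤ n + 2)]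
  have h2 : ∀ i, law D {ω | √((n + 1 : ℕ) * logTerm m δ (n + 2) / 2) <
      |∑ l ∈ Finset.range (n + 1), ω.1 (i, l) - (n + 1 : ℕ) * mean D i|} ≤
      ENNReal.ofReal (2 * (δ / (12 * (m : ℝ) ^ 2 * ((n : ℝ) + 2) ^ 2))) := by
    intro i
    refine (law_lt_abs_sum_sub_le hD.1 i (n + 1) (Real.sqrt_nonneg _)).trans_eq ?_
    have h3 := exp_neg_logTerm hm h0 (by omega : 1 ≤ n + 2)
    push_cast at h3
    rw [← h3, Real.sq_sqrt (by positivity)]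
    congr 3
    field_simp
  refine (measure_iUnion_fintype_le _ _).trans ((Finset.sum_le_sum fun i _ => h2 i).trans ?_)
  rw [Finset.sum_const, Finset.card_univ, Fintype.card_fin, nsmul_eq_mul, ← ENNReal.ofReal_natCast,
    ← ENNReal.ofReal_mul (by positivity)]
  refine ENNReal.ofReal_le_ofReal ?_
  calc (m : ℝ) * (2 * (δ / (12 * (m : ℝ) ^ 2 * ((n : ℝ) + 2) ^ 2)))
      = δ / (6 * m) / ((n : ℝ) + 2) ^ 2 := by field_simp; norm_num
    _ ≤ δ / 12 / ((n : ℝ) + 2) ^ 2 := by gcongr; linarith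

/-- The number of samples inside `logSamples` cancels the factor from the union bound over samples.
-/
theorem law_noiseFails_le (hm : 2 ≤ m) (h0 : 0 < δ) (h1 : δ ≤ q) (h2 : q ≤ 1 / 10)
    (n : ℕ) : law D (noiseFails m δ q n) ≤ ENNReal.ofReal (δ / 12 / ((n : ℝ) + 2) ^ 2) := by
  have hm2 : (2 : ℝ) ≤ m := by exact_mod_cast hm
  have hL : 0 ≤ logSamples m δ q (m + n + 1) := by
    linarith [log_one_div_ge h0 (h1.trans h2),
      log_one_div_le_logTerm hm h0 (by omega : 1 ≤ m + n + 1),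
      logTerm_le_logSamples hm h0 h1 h2 (by omega : 1 ≤ m + n + 1)]
  have hM : (0 : ℝ) < numSamples m δ q (m + n + 1) := by
    exact_mod_cast numSamples_pos hm h0 h1 h2 (by omega)
  refine (law_exists_lt_abs_noise_le D _ _ (Real.sqrt_nonneg _)).trans
    (ENNReal.ofReal_le_ofReal ?_)
  rw [Real.sq_sqrt (by positivity), show -(2 * logSamples m δ q (m + n + 1)) / 2 =
    -logSamples m δ q (m + n + 1) by ring, logSamples, Real.exp_neg, Real.exp_log (by positivity)]
  calc _ = δ / (6 * m) / ((m + n + 1 : ℕ) : ℝ) ^ 2 := by field_simp; norm_num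
    _ ≤ δ / 12 / ((n : ℝ) + 2) ^ 2 := by
      have ht : (n : ℝ) + 2 ≤ ((m + n + 1 : ℕ) : ℝ) := by push_cast; linarith
      gcongr
      linarith

/-- Each sample succeeds with probability exactly `q`, and `(1 - q)^M ≤ exp (-q M) ≤ exp (-L)`. -/
theorem rowLaw_pairFails_le (hm : 2 ≤ m) (h0 : 0 < δ) (h1 : δ ≤ q) (h2 : q ≤ 1 / 10) {t : ℕ}
    (ht : 1 ≤ t) (v : (Fin m → ℕ) × Fin m) :
    rowLaw m (pairFails δ q a t v) ≤ ENNReal.ofReal (δ / (12 * (m : ℝ) ^ 2 * (t : ℝ) ^ 2)) := by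
  by_cases hv : v.2 ≠ a ∧ 0 < v.1 a
  · have hq : 0 < q := h0.trans_le h1
    have hL : 0 < logTerm m δ t := by
      linarith [log_one_div_ge h0 (h1.trans h2), log_one_div_le_logTerm hm h0 ht]
    have hφ := upperQuantile_pos hq h2
    have hva : (0 : ℝ) < v.1 a := by exact_mod_cast hv.2
    have hC : 0 < varParam m δ q t / v.1 a := by
      unfold varParam
      positivity
    refine (measure_mono fun x hx => hx.2).trans ((rowLaw_forall_lt hv.1.symm
      (Real.sqrt_pos.2 hC).ne' _ _ _).trans_le (ENNReal.ofReal_le_ofReal ?_))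
    rw [gaussTail_upperQuantile hq (by linarith), ← exp_neg_logTerm hm h0 ht]
    have hM : 1 / q * logTerm m δ t ≤ numSamples m δ q t := Nat.le_ceil _
    calc (1 - q) ^ numSamples m δ q t ≤ Real.exp (-q) ^ numSamples m δ q t := by
          refine pow_le_pow_left₀ (by linarith) ?_ _
          linarith [Real.add_one_le_exp (-q)]
      _ = Real.exp (-(q * numSamples m δ q t)) := by
          rw [← Real.exp_nat_mul]
          congr 1
          ring
      _ ≤ _ := by
          gcongr
          rw [one_div, inv_mul_le_iff₀ hq] at hM
          exact hM
  · have : pairFails δ q a t v = ∅ := Set.eq_empty_of_forall_notMem fun x hx => hv hx.1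
    simp [this]

theorem measurableSet_pairFails (t : ℕ) (v : (Fin m → ℕ) × Fin m) :
    MeasurableSet (pairFails δ q a t v) := by
  have h : MeasurableSet (⋂ k, ⋂ (_ : k < numSamples m δ q t), {x : ℕ × Fin m → ℝ |
      √(varParam m δ q t / v.1 a) * x (k, a) - √(varParam m δ q t / v.1 v.2) * x (k, v.2) <
      upperQuantile q *
        √(√(varParam m δ q t / v.1 a) ^ 2 + √(varParam m δ q t / v.1 v.2) ^ 2)}) :=
    MeasurableSet.iInter fun k => MeasurableSet.iInter fun _ =>
      measurableSet_lt (by fun_prop) (by fun_prop)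
  convert (MeasurableSet.const (v.2 ≠ a ∧ 0 < v.1 a)).inter h using 1
  ext
  simp [pairFails]

/-- Counts and empirically best arm form a countable-valued function of the past, so the bound for
fixed values transfers through `law_row_mem_le`. -/
theorem law_optimismFails_le (hm : 2 ≤ m) (h0 : 0 < δ) (h1 : δ ≤ q) (h2 : q ≤ 1 / 10)
    (n : ℕ) : law D (optimismFails r δ q a n) ≤ ENNReal.ofReal (δ / 12 / ((n : ℝ) + 2) ^ 2) := by
  have hm2 : (2 : ℝ) ≤ m := by exact_mod_cast hm
  refine (law_row_mem_le D (m + n + 1) (measurable_run_N_best r δ q n)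
    (fun ω => by simp only [run_past r δ q ω n (by omega : m + n < m + n + 1)])
    (measurableSet_pairFails (m + n + 1))
    (rowLaw_pairFails_le hm h0 h1 h2 (by omega))).trans (ENNReal.ofReal_le_ofReal ?_)
  calc _ = δ / (12 * (m : ℝ) ^ 2) / ((m + n + 1 : ℕ) : ℝ) ^ 2 := by rw [div_div]
    _ ≤ δ / 12 / ((n : ℝ) + 2) ^ 2 := by
      have ht : (n : ℝ) + 2 ≤ ((m + n + 1 : ℕ) : ℝ) := by push_cast; linarith
      gcongr
      nlinarith

/-- Telescoping: `1 / (n + 2)² ≤ 1 / (n + 1) - 1 / (n + 2)`. -/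
theorem tsum_ofReal_div_sq_le (h0 : 0 ≤ δ) :
    ∑' n : ℕ, ENNReal.ofReal (δ / ((n : ℝ) + 2) ^ 2) ≤ ENNReal.ofReal δ := by
  refine ENNReal.tsum_le_of_sum_range_le fun N => ?_
  rw [← ENNReal.ofReal_sum_of_nonneg fun n _ => by positivity]
  refine ENNReal.ofReal_le_ofReal ?_
  have h : ∑ n ∈ Finset.range N, δ / ((n : ℝ) + 2) ^ 2 ≤ δ * (1 - 1 / ((N : ℝ) + 1)) := by
    induction N with
    | zero => simp
    | succ N ih =>
      rw [Finset.sum_range_succ]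
      have h2 : δ / ((N : ℝ) + 2) ^ 2 ≤ δ * (1 / ((N : ℝ) + 1) - 1 / ((N : ℝ) + 2)) := by
        rw [div_eq_mul_one_div]
        gcongr
        rw [div_sub_div _ _ (by positivity) (by positivity),
          div_le_div_iff₀ (by positivity) (by positivity)]
        nlinarith [(Nat.cast_nonneg N : (0 : ℝ) ≤ N)]
      push_cast
      rw [show (N : ℝ) + 1 + 1 = N + 2 by ring]
      nlinarith
  refine h.trans (mul_le_of_le_one_right h0 ?_)
  have : (0 : ℝ) ≤ 1 / ((N : ℝ) + 1) := by positivity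
  linarith

/-- The event that some of the good events fail. -/
def runFails (D : Fin m → ProbabilityMeasure ℝ) (r : Rules m) (δ q : ℝ) (a : Fin m) :
    Set (Outcome m) :=
  (⋃ n, (rewardFails D δ n ∪ noiseFails m δ q n ∪ optimismFails r δ q a n)) ∪
    ⋃ t, ⋃ k, ⋃ i, ⋃ j, ⋃ u, ⋃ v, tie m δ q t k i j u v

theorem law_runFails_le (hm : 2 ≤ m) (hD : IsInstance D a) (h0 : 0 < δ) (h1 : δ ≤ q)
    (h2 : q ≤ 1 / 10) : law D (runFails D r δ q a) ≤ ENNReal.ofReal δ := by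
  have htie : law D (⋃ t, ⋃ k, ⋃ i, ⋃ j, ⋃ u, ⋃ v, tie m δ q t k i j u v) = 0 := by
    simp only [measure_iUnion_null_iff]
    exact fun t k i j u v => law_tie_eq_zero t k i j u v
  refine (measure_union_le _ _).trans ?_
  rw [htie, add_zero]
  refine (measure_iUnion_le _).trans (le_trans (ENNReal.tsum_le_tsum fun n => ?_)
    (tsum_ofReal_div_sq_le h0.le))
  refine (measure_union_le _ _).trans ((add_le_add ((measure_union_le _ _).trans (add_le_add
    (law_rewardFails_le hm hD h0 (h1.trans h2) n) (law_noiseFails_le hm h0 h1 h2 n)))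
    (law_optimismFails_le hm h0 h1 h2 n)).trans ?_)
  rw [← ENNReal.ofReal_add (by positivity) (by positivity),
    ← ENNReal.ofReal_add (by positivity) (by positivity)]
  refine ENNReal.ofReal_le_ofReal ?_
  rw [← add_div, ← add_div]
  gcongr
  linarith

theorem goodStep_of_notMem_runFails (hm : 2 ≤ m) (h0 : 0 < δ) (h1 : δ ≤ q)
    (h2 : q ≤ 1 / 10) {ω : Outcome m} (hω : ω ∉ runFails D r δ q a) (n : ℕ) :
    GoodStep D a r δ q ω.2 (m + n + 1) (run r δ q ω n) := by
  simp only [runFails, Set.mem_union, Set.mem_iUnion, not_or, not_exists] at hω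
  obtain ⟨hω, htie⟩ := hω
  have hN := run_N_pos r δ q ω n
  have hL : 0 < logTerm m δ (m + n + 1) := by
    linarith [log_one_div_ge h0 (h1.trans h2),
      log_one_div_le_logTerm hm h0 (by omega : 1 ≤ m + n + 1)]
  have hC : 0 < varParam m δ q (m + n + 1) :=
    div_pos hL (pow_pos (upperQuantile_pos (h0.trans_le h1) h2) 2)
  refine ⟨fun i => ?_, fun k hk i => ?_, fun hb => ?_, fun k _ i j hij h => ?_⟩
  · obtain ⟨u, hu⟩ := Nat.exists_eq_succ_of_ne_zero (hN i).ne'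
    have h3 := (hω u).1.1
    simp only [rewardFails, Set.mem_iUnion, not_exists, Set.mem_ofPred_eq, not_lt] at h3
    have h4 := h3 i
    -- `rewardFails` is indexed by pull count. A count of `u + 1` forces `u ≤ n`, so the radius at
    -- time `u + 2` is no larger than the current one.
    have hle := run_N_le r δ q ω n i
    rw [Nat.succ_eq_add_one] at hu
    rw [← hu, ← run_R] at h4
    have h5 : logTerm m δ (u + 2) ≤ logTerm m δ (m + n + 1) :=
      logTerm_mono hm h0 (by omega) (by omega)
    have hv : (0 : ℝ) < (run r δ q ω n).N i := by exact_mod_cast hN i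
    set v : ℝ := (((run r δ q ω n).N i : ℕ) : ℝ)
    have h6 : (run r δ q ω n).empMean i - mean D i
        = ((run r δ q ω n).R i - v * mean D i) / v := by
      rw [State.empMean, sub_div, mul_div_cancel_left₀ _ hv.ne']
    rw [h6, abs_div, abs_of_pos hv, div_le_iff₀ hv]
    refine h4.trans (Real.sqrt_le_left (by positivity) |>.2 ?_)
    rw [mul_pow, Real.sq_sqrt (by positivity)]
    calc v * logTerm m δ (u + 2) / 2 ≤ v * logTerm m δ (m + n + 1) / 2 := by gcongr
      _ = _ := by field_simp
  · by_contra! h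
    exact (hω n).1.2 ⟨k, hk, i, h⟩
  · by_contra! h
    exact (hω n).2 ⟨⟨hb, hN a⟩, h⟩
  · refine htie (m + n + 1) k i j ((run r δ q ω n).N i) ((run r δ q ω n).N j)
      ⟨⟨hij, hN i, hC⟩, ?_⟩
    rw [← run_R, ← run_R]
    simp only [State.sample, State.empMean] at h
    linarith

theorem one_sub_le_law_outputsWithin (hm : 2 ≤ m) (hD : IsInstance D a) (h0 : 0 < δ)
    (h1 : δ ≤ q) (h2 : q ≤ 1 / 10) {B : ℝ}
    (hB : ∀ T : ℕ, m ≤ T →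
      (T : ℝ) ≤ m + 396 * logTerm m δ T ^ 2 / Real.log (1 / q) * hardness D a → (T : ℝ) ≤ B) :
    1 - δ ≤ (law D).real (outputsWithin r δ q a B) := by
  have h3 : (outputsWithin r δ q a B)ᶜ ⊆ runFails D r δ q a := by
    intro ω hω
    by_contra h
    have hg := goodStep_of_notMem_runFails hm h0 h1 h2 h
    exact hω (mem_outputsWithin_of_good hm hD h0 h1 h2 hg fun n ho =>
      hB (m + n) (by omega) (time_le_of_good hm hD h0 h1 h2 hg n ho))
  have h4 : (law D).real (runFails D r δ q a) ≤ δ :=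
    ENNReal.toReal_le_of_le_ofReal h0.le (law_runFails_le hm hD h0 h1 h2)
  -- Subadditivity suffices for the lower bound and spares the measurability of `outputsWithin`.
  have h5 := measureReal_union_le (μ := law D) (outputsWithin r δ q a B)
    (outputsWithin r δ q a B)ᶜ
  rw [Set.union_compl_self, probReal_univ] at h5
  linarith [measureReal_mono (μ := law D) h3]

/-! ### Solving for the duration -/

/-- If `log T ≤ d` the claim is immediate. Otherwise `T ≤ 25344 Y log² T`, and a crude bound is
bootstrapped: it gives `√T = O(Y)`, hence `log T = O(g)`, which is substituted back. -/
theorem le_of_le_mul_log_sq {T Y H g d : ℝ} (hT : 2 ≤ T) (hYH : Y ≤ H) (hY : 0 < Y)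
    (hg : Real.log H ≤ g) (hg4 : Real.log 4 ≤ g) (hd : 0 ≤ d)
    (h : T ≤ 12672 * Y * (d ^ 2 + Real.log T ^ 2)) :
    T ≤ 12266496 * Y * (d ^ 2 + g ^ 2) := by
  have hlT : 0 ≤ Real.log T := Real.log_nonneg (by linarith)
  have hYd : 0 ≤ Y * d ^ 2 := by positivity
  have hYg : 0 ≤ Y * g ^ 2 := by positivity
  rcases le_total (Real.log T) d with hle | hle
  · have h1 : Real.log T ^ 2 ≤ d ^ 2 := by gcongr
    have : Y * Real.log T ^ 2 ≤ Y * d ^ 2 := by gcongr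
    nlinarith
  · set w := √(√T) with hw
    have hT0 : 0 < √T := Real.sqrt_pos.2 (by linarith)
    have hw0 : 0 < w := Real.sqrt_pos.2 hT0
    have hw2 : w ^ 2 = √T := Real.sq_sqrt hT0.le
    have hw4 : w ^ 4 = T := by
      rw [show w ^ 4 = (w ^ 2) ^ 2 by ring, hw2, Real.sq_sqrt (by linarith)]
    have hlog : Real.log T = 4 * Real.log w := by
      rw [← hw4, Real.log_pow]
      norm_num
    have hlw : Real.log T ≤ 4 * w := by
      rw [hlog]
      linarith [Real.log_le_sub_one_of_pos hw0]
    have h1 : d ^ 2 ≤ Real.log T ^ 2 := by gcongr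
    have h2 : T ≤ 25344 * Y * Real.log T ^ 2 := by
      have : Y * d ^ 2 ≤ Y * Real.log T ^ 2 := by gcongr
      nlinarith
    have h3 : w ^ 2 ≤ 405504 * Y := by
      have h4 : Real.log T ^ 2 ≤ (4 * w) ^ 2 := by gcongr
      have h5 : w ^ 2 * w ^ 2 ≤ 405504 * Y * w ^ 2 := by
        calc w ^ 2 * w ^ 2 = T := by rw [← hw4]; ring
          _ ≤ 25344 * Y * (4 * w) ^ 2 := h2.trans (by gcongr)
          _ = _ := by ring
      exact le_of_mul_le_mul_right h5 (by positivity)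
    have hH0 : 0 < H := hY.trans_le hYH
    have h6 : Real.log T ≤ 22 * g := by
      have h7 : Real.log (w ^ 2) ≤ Real.log (4 ^ 10 * H) := by
        refine Real.log_le_log (by positivity) (h3.trans ?_)
        have : 405504 * Y ≤ 405504 * H := by gcongr
        linarith
      rw [Real.log_pow, Real.log_mul (by norm_num) hH0.ne', Real.log_pow] at h7
      push_cast at h7
      linarith
    calc T ≤ 25344 * Y * Real.log T ^ 2 := h2
      _ ≤ 25344 * Y * (22 * g) ^ 2 := by gcongr
      _ ≤ _ := by linarith

theorem logTerm_sq_le (hm : 2 ≤ m) (h0 : 0 < δ) (h1 : δ ≤ 1 / 10) {T : ℕ} (hT : m ≤ T) :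
    logTerm m δ T ^ 2 ≤ 18 * Real.log (1 / δ) ^ 2 + 32 * Real.log T ^ 2 := by
  have hm2 : (2 : ℝ) ≤ m := by exact_mod_cast hm
  have hmT : (m : ℝ) ≤ T := by exact_mod_cast hT
  have hT0 : (0 : ℝ) < T := by linarith
  have h2 : logTerm m δ T = Real.log 12 + 2 * Real.log m + 2 * Real.log T + Real.log (1 / δ) := by
    rw [logTerm, show 12 * (m : ℝ) ^ 2 * (T : ℝ) ^ 2 / δ = 12 * (m : ℝ) ^ 2 * (T : ℝ) ^ 2 * (1 / δ)
      by ring, Real.log_mul (by positivity) (by positivity),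
      Real.log_mul (by positivity) (by positivity), Real.log_mul (by positivity) (by positivity),
      Real.log_pow, Real.log_pow]
    norm_num
  have h3 : Real.log m ≤ Real.log T := Real.log_le_log (by linarith) hmT
  have h4 : Real.log 12 ≤ 2 * Real.log (1 / δ) := by
    have h5 : (10 : ℝ) ≤ 1 / δ := by rw [le_div_iff₀ h0]; linarith
    calc Real.log 12 ≤ Real.log ((1 / δ) ^ 2) := Real.log_le_log (by norm_num) (by nlinarith)
      _ = _ := by rw [Real.log_pow]; norm_num
  have h6 := log_one_div_le_logTerm hm h0 (by omega : 1 ≤ T)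
  have h7 := log_one_div_ge h0 h1
  have h8 : logTerm m δ T ^ 2 ≤ (4 * Real.log T + 3 * Real.log (1 / δ)) ^ 2 := by
    gcongr
    · linarith
    · linarith
  nlinarith [sq_nonneg (4 * Real.log T - 3 * Real.log (1 / δ)), sq_nonneg (Real.log (1 / δ))]

theorem time_le (hm : 2 ≤ m) (hD : IsInstance D a) (h0 : 0 < δ) (h1 : δ ≤ q) (h2 : q ≤ 1 / 10)
    {T : ℕ} (hmT : m ≤ T)
    (hT : (T : ℝ) ≤ m + 396 * logTerm m δ T ^ 2 / Real.log (1 / q) * hardness D a) :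
    (T : ℝ) ≤ 12266496 * (hardness D a / Real.log (1 / q)) *
      (Real.log (1 / δ) ^ 2 + Real.log (m * hardness D a) ^ 2) := by
  have hm2 : (2 : ℝ) ≤ m := by exact_mod_cast hm
  have hH := le_hardness hm hD
  have hq : 0 < q := h0.trans_le h1
  have hl := log_one_div_ge hq h2
  have hd : Real.log (1 / q) ≤ Real.log (1 / δ) :=
    Real.log_le_log (by positivity) (one_div_le_one_div_of_le h0 h1)
  have hL := logTerm_sq_le hm h0 (h1.trans h2) hmT
  set H := hardness D a
  set l := Real.log (1 / q)
  set d := Real.log (1 / δ)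
  have hl0 : 0 < l := by linarith
  have hH0 : 0 < H := by linarith
  refine le_of_le_mul_log_sq (H := H) (by exact_mod_cast hm.trans hmT) ?_ (by positivity) ?_ ?_
    (by linarith) ?_
  · exact div_le_self hH0.le (by linarith)
  · exact Real.log_le_log hH0 (le_mul_of_one_le_left hH0.le (by linarith))
  · exact Real.log_le_log (by norm_num) (by nlinarith)
  · have h3 : H ≤ H / l * d ^ 2 := by
      rw [div_mul_eq_mul_div, le_div_iff₀ hl0]
      gcongr
      nlinarith
    have h4 : 396 * logTerm m δ T ^ 2 / l * H ≤
        396 * (18 * d ^ 2 + 32 * Real.log T ^ 2) / l * H := by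
      gcongr
    have h5 : 396 * (18 * d ^ 2 + 32 * Real.log T ^ 2) / l * H =
        7128 * (H / l * d ^ 2) + 12672 * (H / l * Real.log T ^ 2) := by ring
    have h6 : 0 ≤ H / l * d ^ 2 := by positivity
    linarith

end TSExplore

/-! ### The three bounds. -/

theorem corollary4p3 :
    ∃ K : ℝ, 0 < K ∧ ∀ (m : ℕ) (_ : 2 ≤ m) (D : Fin m → ProbabilityMeasure ℝ) (a : Fin m)
      (_ : TSExplore.IsInstance D a) (r : TSExplore.Rules m),
      (∀ δ q : ℝ, 0 < δ → δ ≤ q → q ≤ 1 / 10 →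
        1 - δ ≤ (TSExplore.law D).real (TSExplore.outputsWithin r δ q a
          (K * (TSExplore.hardness D a *
              (Real.log (1 / δ) + Real.log (m * TSExplore.hardness D a)) *
              (Real.log (1 / δ) / Real.log (1 / q)) +
            TSExplore.hardness D a *
              (Real.log (m * TSExplore.hardness D a) ^ 2 / Real.log (1 / q)))))) ∧
      (∀ δ : ℝ, 0 < δ → δ ≤ 1 / 10 →
        1 - δ ≤ (TSExplore.law D).real (TSExplore.outputsWithin r δ δ a
          (K * (TSExplore.hardness D a * Real.log (1 / δ) +
            TSExplore.hardness D a * Real.log (m * TSExplore.hardness D a) ^ 2)))) ∧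
      (∀ᶠ δ : ℝ in 𝓝[>] 0,
        1 - δ ≤ (TSExplore.law D).real (TSExplore.outputsWithin r δ δ a
          (K * (TSExplore.hardness D a * Real.log (1 / δ))))) := by
  -- Twice the constant of `time_le`: in the asymptotic claim both summands are bounded by `H log
  -- (1/δ)`.
  refine ⟨24532992, by norm_num, fun m hm D a hD r => ?_⟩
  have hm2 : (2 : ℝ) ≤ m := by exact_mod_cast hm
  have hH := TSExplore.le_hardness hm hD
  have hg : 0 ≤ Real.log (m * TSExplore.hardness D a) := Real.log_nonneg (by nlinarith)
  have hT := fun (δ q : ℝ) (h0 : 0 < δ) (h1 : δ ≤ q) (h2 : q ≤ 1 / 10) (T : ℕ) (hmT : m ≤ T) =>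
    TSExplore.time_le hm hD h0 h1 h2 (T := T) hmT
  set H := TSExplore.hardness D a
  set g := Real.log (m * H)
  have hH0 : 0 < H := by linarith
  refine ⟨fun δ q h0 h1 h2 => ?_, fun δ h0 h1 => ?_, ?_⟩
  · refine TSExplore.one_sub_le_law_outputsWithin hm hD h0 h1 h2 fun T hmT h =>
      (hT δ q h0 h1 h2 T hmT h).trans ?_
    have hl := log_one_div_ge (h0.trans_le h1) h2
    have hd := log_one_div_ge h0 (h1.trans h2)
    set l := Real.log (1 / q)
    set d := Real.log (1 / δ)
    have hl0 : 0 < l := by linarith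
    have hd0 : 0 < d := by linarith
    have e1 : 0 ≤ H / l * (d * g) := by positivity
    have e2 : 0 ≤ H / l * d ^ 2 := by positivity
    have e3 : 0 ≤ H / l * g ^ 2 := by positivity
    have e4 : 24532992 * (H * (d + g) * (d / l) + H * (g ^ 2 / l)) =
      24532992 * (H / l * d ^ 2 + H / l * (d * g) + H / l * g ^ 2) := by ring
    rw [e4]
    linarith
  · refine TSExplore.one_sub_le_law_outputsWithin hm hD h0 le_rfl h1 fun T hmT h =>
      (hT δ δ h0 le_rfl h1 T hmT h).trans ?_
    have hd := log_one_div_ge h0 h1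
    set d := Real.log (1 / δ)
    have hd0 : 0 < d := by linarith
    have e1 : 0 ≤ H * d := by positivity
    have e2 : H / d * g ^ 2 ≤ H * g ^ 2 := by
      gcongr
      exact div_le_self hH0.le (by linarith)
    have e3 : H / d * d ^ 2 = H * d := by field_simp
    have e4 : 0 ≤ H * g ^ 2 := by positivity
    rw [mul_assoc, mul_add, e3]
    linarith
  · have hlim : Tendsto (fun δ : ℝ => Real.log (1 / δ)) (𝓝[>] 0) atTop := by
      simp only [one_div]
      exact Real.tendsto_log_atTop.comp tendsto_inv_nhdsGT_zero
    have hsmall : ∀ᶠ δ : ℝ in 𝓝[>] 0, δ < 1 / 10 :=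
      eventually_nhdsWithin_of_eventually_nhds (gt_mem_nhds (by norm_num))
    -- Once `log (1/δ) ≥ g²`, the term `H g² / log (1/δ)` is at most `H`.
    filter_upwards [self_mem_nhdsWithin, hsmall, hlim.eventually_ge_atTop (g ^ 2)] with δ h0 h1 h3
    refine TSExplore.one_sub_le_law_outputsWithin hm hD h0 le_rfl h1.le fun T hmT h =>
      (hT δ δ h0 le_rfl h1.le T hmT h).trans ?_
    have hd := log_one_div_ge h0 h1.le
    set d := Real.log (1 / δ)
    have hd0 : 0 < d := by linarith
    have e2 : H / d * g ^ 2 ≤ H * d := by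
      calc H / d * g ^ 2 ≤ H / d * d := by gcongr
        _ = H := by field_simp
        _ ≤ H * d := le_mul_of_one_le_right hH0.le (by linarith)
    have e3 : H / d * d ^ 2 = H * d := by field_simp
    rw [mul_assoc, mul_add, e3]
    linarith
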